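/- **Setting.** Let $n,\nu,m_1,m_2,p_1,p_2$ be even, and let $m=m_1+m_2$. Put $\mathbf J=\begin{bmatrix}0&1\\-1&0\end{bmatrix}$, $J_k=I_{m_k/2}\otimes\mathbf J$, $J=\operatorname{diag}(J_1,J_2)$, $\Omega=I_m+iJ$ and $S=\sqrt{\Omega^{T}}=\tfrac1{\sqrt2}\Omega^{T}$. Fixed data: real nonsingular antisymmetric matrices $\Theta_1\in\mathbb R^{n\times n}$, $\Theta_2\in\mathbb R^{\nu\times\nu}$, with $\Theta=\operatorname{diag}(\Theta_1,\Theta_2)$; real matrices $R_1=R_1^T\in\mathbb R^{n\times n}$, $M_1\in\mathbb R^{m_1\times n}$, $L_1\in\mathbb R^{p_2\times n}$; matrices $D\in\mathbb R^{p_1\times m_1}$, $d\in\mathbb R^{p_2\times m_2}$ formed from conjugate pairs of rows of permutation matrices (that is, $D$, $d$ select $p_1/2$, $p_2/2$ distinct conjugate pairs of channels), so that $\widetilde J_1=DJ_1D^T=I_{p_1/2}\otimes\mathbf J$ and $\widetilde J_2=dJ_2d^T=I_{p_2/2}\otimes\mathbf J$; and weights $N\in\mathbb R^{r\times n}$, $K\in\mathbb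 R^{r\times p_2}$. The plant has $$A=2\Theta_1(R_1+M_1^TJ_1M_1+L_1^T\widetilde J_2L_1),\quad B=2\Theta_1M_1^T,\quad C=2DJ_1M_1,\quad E=2\Theta_1L_1^T .$$ A coherent quantum controller is given by a triple $\mathcal E=(R_2,M_2,L_2)$ with $R_2=R_2^T\in\mathbb R^{\nu\times\nu}$, $M_2\in\mathbb R^{m_2\times\nu}$, $L_2\in\mathbb R^{p_1\times\nu}$, through $$a=2\Theta_2(R_2+M_2^TJ_2M_2+L_2^T\widetilde J_1L_2),\quad b=2\Theta_2M_2^T,\quad c=2dJ_2M_2,\quad e=2\Theta_2L_2^T ,$$ and the closed-loop system has $$\mathcal A=\begin{bmatrix}A&Ec\\eC&a\end{bmatrix},\quad \mathcal B=\begin{bmatrix}B&Ed\\eD&b\end{bmatrix},\quad \mathcal C=\begin{bmatrix}N&Kc\end{bmatrix},\quad F(s)=\mathcal C(sI-\mathcal A)^{-1}\mathcal B .$$ Write $F=F(i\lambda)$, $\Phi=FF^*$, $\Psi=FJF^*$ for $\lambda\in\mathbb R$. For $\theta>0$ the risk-sensitive cost is the growth rate of the quadratic-exponential functional, in its frequency-domain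 form $$\Upsilon_\theta=-\frac1{4\pi}\int_{\mathbb R}\ln\det D_\theta(\lambda)\,d\lambda,\qquad D_\theta=\cos(\theta\Psi)-\theta\,\Phi\operatorname{sinc}(\theta\Psi).$$ The controller is *admissible* if (i) $\mathcal A$ is Hurwitz; (ii) for all sufficiently large $T>0$ the integral operator $f\mapsto\int_0^T\Lambda(\cdot-t)f(t)\,dt$ on $L^2([0,T],\mathbb C^r)$ is injective, where $\Lambda(\tau)=\mathcal C e^{\tau\mathcal A}\Theta\,\mathcal C^T$ for $\tau\ge0$ and $\Lambda(\tau)=\mathcal C\Theta e^{-\tau\mathcal A^T}\mathcal C^T$ for $\tau<0$; (iii) $\theta\sup_{\lambda}\lambda_{\max}\big(\Phi(\lambda)\operatorname{tanc}(\theta\Psi(\lambda))\big)<1$, where $\operatorname{tanc}z=\tan z/z$. With $\phi(u)=(e^u-1)/u$, let $\Delta_\theta=I_m-\theta\,SF^*\phi(2i\theta\Psi)FS$, let $\varpi_\theta$ be the bottom-left $r\times r$ block of $\phi\left(\begin{bmatrix}2i\theta\Psi&0\\FS\Delta_\theta^{-1}SF^*&2i\theta\Psi\end{bmatrix}\right)$,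 and let $\mathfrak M_{\theta,F}$ be the frequency-dependent operator on $\mathbb C^{r\times m}$ $$\mathfrak M_{\theta,F}(X)=\phi(2i\theta\Psi)\,X\,S\Delta_\theta^{-1}S+\varpi_\theta\,X\,(2i\theta J).$$ For a fixed frequency-dependent operator $\mathfrak M$, the weighted coherent quantum LQG cost is $$V=\frac1{4\pi}\int_{\mathbb R}\langle F,\mathfrak M(F)\rangle\,d\lambda,\qquad\langle X,Y\rangle=\operatorname{Tr}(X^*Y).$$ A controller is a *stationary point* of the problem with cost $\Upsilon$ (one of $\Upsilon_\theta$, $V$, regarded as a function of $(\mathcal A,\mathcal B,\mathcal C)$) if $$\mathbf S(\Theta_2\,\partial_a\Upsilon)=0,\qquad 2J_2M_2\mathbf A(\Theta_2\,\partial_a\Upsilon)+\partial_b\Upsilon^T\Theta_2-J_2d^T\partial_c\Upsilon=0,\qquad 2\widetilde J_1L_2\mathbf A(\Theta_2\,\partial_a\Upsilon)+\partial_e\Upsilon^T\Theta_2=0,$$ where $\mathbf S(\mu)=\frac12(\mu+\mu^T)$, $\mathbf A(\mu)=\frac12(\mu-\mu^T)$ and $\partial_a,\partial_b,\partial_c,\partial_e$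 are the partial Fréchet derivatives (Frobenius gradients) with respect to $a,b,c,e$ as independent variables. **Theorem.** Let $\theta>0$, let $\mathcal E$ be an admissible controller with closed-loop transfer function $F_*$, and fix $\mathfrak M:=\mathfrak M_{\theta,F_*}$. Then $\mathfrak M$ is self-adjoint at every frequency and its operator norm is bounded uniformly over the frequency. The integrals defining $\Upsilon_\theta$ and $V$ converge for all $(\mathcal A,\mathcal B,\mathcal C)$ near those of the closed-loop system; $\Upsilon_\theta$ and $V$ are Fréchet differentiable functions of $(\mathcal A,\mathcal B,\mathcal C)$ there; and their core matrices coincide: $$\theta^{-1}\,\partial_{\mathcal A,\mathcal B,\mathcal C}\Upsilon_\theta=\partial_{\mathcal A,\mathcal B,\mathcal C}V .$$ The controller is a stationary point of the risk-sensitive problem $\Upsilon_\theta\to\inf$ if and only if it is a stationary point of the weighted coherent quantum LQG problem $V\to\inf$. Likewise, the Fréchet derivative of $\mathcal E\mapsto\Upsilon_\theta$ vanishes at the controller if and only if that of $\mathcal E\mapsto V$ does. -/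

import Mathlib

open scoped Matrix Kronecker Topology
open MeasureTheory Filter

noncomputable section

namespace CQRS

/-! ### Quantum fields -/

/-- Index set of a quantum field with `2 * k` channels, organised into `k` conjugate pairs. -/
abbrev FieldIdx (k : ℕ) : Type := Fin k × Fin 2

/-- Index set of the combined external noise of the plant and the controller. -/
abbrev NoiseIdx (k₁ k₂ : ℕ) : Type := FieldIdx k₁ ⊕ FieldIdx k₂

/-- The commutation matrix of a field, block-diagonal with `k` blocks `[[0, 1], [-1, 0]]`. -/
def fieldJ (k : ℕ) : Matrix (FieldIdx k) (FieldIdx k) ℝ :=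
  (1 : Matrix (Fin k) (Fin k) ℝ) ⊗ₖ !![0, 1; -1, 0]

/-- The commutation matrix `J` of the combined external noise. -/
def noiseJ (k₁ k₂ : ℕ) : Matrix (NoiseIdx k₁ k₂) (NoiseIdx k₁ k₂) ℝ :=
  Matrix.fromBlocks (fieldJ k₁) 0 0 (fieldJ k₂)

/-- The real matrix `J` regarded as a complex one. -/
def noiseJC (k₁ k₂ : ℕ) : Matrix (NoiseIdx k₁ k₂) (NoiseIdx k₁ k₂) ℂ :=
  (noiseJ k₁ k₂).map Complex.ofReal

/-- The quantum Ito matrix `Ω = I + i J`. -/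
def itoMatrix (k₁ k₂ : ℕ) : Matrix (NoiseIdx k₁ k₂) (NoiseIdx k₁ k₂) ℂ :=
  1 + Complex.I • noiseJC k₁ k₂

/-- `S = Ωᵀ / √2`; it is the positive semi-definite square root of `Ωᵀ`. -/
def itoRoot (k₁ k₂ : ℕ) : Matrix (NoiseIdx k₁ k₂) (NoiseIdx k₁ k₂) ℂ :=
  ((1 / Real.sqrt 2 : ℝ) : ℂ) • (itoMatrix k₁ k₂)ᵀ

/-- Feedthrough matrix of an oscillator whose output consists of the conjugate pairs number
`σ 0, σ 1, …` of its input channels: `q` conjugate pairs of rows of a permutation matrix. -/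
def feedthrough {k q : ℕ} (σ : Fin q ↪ Fin k) : Matrix (FieldIdx q) (FieldIdx k) ℝ :=
  Matrix.of fun i j => if σ i.1 = j.1 ∧ i.2 = j.2 then 1 else 0

/-! ### Plant, controller and closed-loop system -/

/-- The fixed data of the control problem: a quantum plant with `n` variables, the commutation
and feedthrough matrices of a controller with `ν` variables, and the weights of the criterion
process. The external noises of plant and controller have `2 * k₁` and `2 * k₂` channels, their
outputs have `2 * q₁` and `2 * q₂` channels, and the criterion process has `r` components. -/
structure Setup (n ν k₁ k₂ q₁ q₂ r : ℕ) where
  /-- commutation matrix of the plant variables -/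
  Θ₁ : Matrix (Fin n) (Fin n) ℝ
  Θ₁_antisymm : Θ₁ᵀ = -Θ₁
  Θ₁_det : Θ₁.det ≠ 0
  /-- commutation matrix of the controller variables -/
  Θ₂ : Matrix (Fin ν) (Fin ν) ℝ
  Θ₂_antisymm : Θ₂ᵀ = -Θ₂
  Θ₂_det : Θ₂.det ≠ 0
  /-- energy matrix of the plant -/
  R₁ : Matrix (Fin n) (Fin n) ℝ
  R₁_symm : R₁ᵀ = R₁
  /-- coupling of the plant to its external noise -/
  M₁ : Matrix (FieldIdx k₁) (Fin n) ℝ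
  /-- coupling of the plant to the controller output -/
  L₁ : Matrix (FieldIdx q₂) (Fin n) ℝ
  /-- the selection of plant noise channels in the plant output -/
  σ₁ : Fin q₁ ↪ Fin k₁
  /-- the selection of controller noise channels in the controller output -/
  σ₂ : Fin q₂ ↪ Fin k₂
  /-- weight of the plant variables in the criterion process -/
  N : Matrix (Fin r) (Fin n) ℝ
  /-- weight of the controller output drift in the criterion process -/
  K : Matrix (Fin r) (FieldIdx q₂) ℝ

/-- The space of real symmetric matrices. -/
def symMat (ν : ℕ) : Submodule ℝ (Matrix (Fin ν) (Fin ν) ℝ) where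
  carrier := {R | Rᵀ = R}
  add_mem' := by
    intro a b ha hb
    change _ᵀ = _ at ha hb ⊢
    rw [Matrix.transpose_add, ha, hb]
  zero_mem' := by simp
  smul_mem' := by
    intro c a ha
    change _ᵀ = _ at ha ⊢
    rw [Matrix.transpose_smul, ha]

/-- The space of triples `(R₂, M₂, L₂)`: energy matrix of the controller and its couplings to
its external noise and to the plant output. -/
abbrev Energetics (ν k₂ q₁ : ℕ) : Type :=
  symMat ν × Matrix (FieldIdx k₂) (Fin ν) ℝ × Matrix (FieldIdx q₁) (Fin ν) ℝ

/-- The space of quadruples `(a, b, c, e)` of controller matrices. -/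
abbrev CtrlMatrices (ν k₂ q₁ q₂ : ℕ) : Type :=
  Matrix (Fin ν) (Fin ν) ℝ × Matrix (Fin ν) (FieldIdx k₂) ℝ ×
    Matrix (FieldIdx q₂) (Fin ν) ℝ × Matrix (Fin ν) (FieldIdx q₁) ℝ

/-- The space of triples `(𝒜, ℬ, 𝒞)` of closed-loop system matrices. -/
abbrev LoopMatrices (n ν k₁ k₂ r : ℕ) : Type :=
  Matrix (Fin n ⊕ Fin ν) (Fin n ⊕ Fin ν) ℝ × Matrix (Fin n ⊕ Fin ν) (NoiseIdx k₁ k₂) ℝ ×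
    Matrix (Fin r) (Fin n ⊕ Fin ν) ℝ

namespace Setup

variable {n ν k₁ k₂ q₁ q₂ r : ℕ} (P : Setup n ν k₁ k₂ q₁ q₂ r)

/-- plant feedthrough -/
def D : Matrix (FieldIdx q₁) (FieldIdx k₁) ℝ := feedthrough P.σ₁

/-- controller feedthrough -/
def d : Matrix (FieldIdx q₂) (FieldIdx k₂) ℝ := feedthrough P.σ₂

/-- commutation matrix of the plant output field -/
def Jt₁ : Matrix (FieldIdx q₁) (FieldIdx q₁) ℝ := P.D * fieldJ k₁ * P.Dᵀ

/-- commutation matrix of the controller output field -/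
def Jt₂ : Matrix (FieldIdx q₂) (FieldIdx q₂) ℝ := P.d * fieldJ k₂ * P.dᵀ

def A : Matrix (Fin n) (Fin n) ℝ :=
  (2 : ℝ) • (P.Θ₁ * (P.R₁ + P.M₁ᵀ * fieldJ k₁ * P.M₁ + P.L₁ᵀ * P.Jt₂ * P.L₁))

def B : Matrix (Fin n) (FieldIdx k₁) ℝ := (2 : ℝ) • (P.Θ₁ * P.M₁ᵀ)

def C : Matrix (FieldIdx q₁) (Fin n) ℝ := (2 : ℝ) • (P.D * fieldJ k₁ * P.M₁)

def E : Matrix (Fin n) (FieldIdx q₂) ℝ := (2 : ℝ) • (P.Θ₁ * P.L₁ᵀ)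

/-- Commutation matrix of the closed-loop system variables. -/
def Θ : Matrix (Fin n ⊕ Fin ν) (Fin n ⊕ Fin ν) ℝ := Matrix.fromBlocks P.Θ₁ 0 0 P.Θ₂

/-- The controller matrices `(a, b, c, e)` of a physically realizable controller with given
energy and coupling matrices `(R₂, M₂, L₂)`. -/
def ctrl (ε : Energetics ν k₂ q₁) : CtrlMatrices ν k₂ q₁ q₂ :=
  ((2 : ℝ) • (P.Θ₂ * ((ε.1 : Matrix (Fin ν) (Fin ν) ℝ) + ε.2.1ᵀ * fieldJ k₂ * ε.2.1
      + ε.2.2ᵀ * P.Jt₁ * ε.2.2)),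
    (2 : ℝ) • (P.Θ₂ * ε.2.1ᵀ),
    (2 : ℝ) • (P.d * fieldJ k₂ * ε.2.1),
    (2 : ℝ) • (P.Θ₂ * ε.2.2ᵀ))

/-- The closed-loop system matrices `(𝒜, ℬ, 𝒞)` for given controller matrices `(a, b, c, e)`. -/
def loop (γ : CtrlMatrices ν k₂ q₁ q₂) : LoopMatrices n ν k₁ k₂ r :=
  (Matrix.fromBlocks P.A (P.E * γ.2.2.1) (γ.2.2.2 * P.C) γ.1,
    Matrix.fromBlocks P.B (P.E * P.d) (γ.2.2.2 * P.D) γ.2.1,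
    Matrix.fromCols P.N (P.K * γ.2.2.1))

/-- The closed-loop system matrices for given controller energy and coupling matrices. -/
def closedLoop (ε : Energetics ν k₂ q₁) : LoopMatrices n ν k₁ k₂ r := P.loop (P.ctrl ε)

end Setup

/-! ### Functions of matrices -/

section MatrixFunctions

variable {ι : Type*} [Fintype ι] [DecidableEq ι]

/-- The entire function `cos` of a matrix. -/
def matCos (X : Matrix ι ι ℂ) : Matrix ι ι ℂ :=
  ∑' k : ℕ, ((-1 : ℂ) ^ k / ((2 * k).factorial : ℂ)) • X ^ (2 * k)

/-- The entire function `sinc z = sin z / z` (with `sinc 0 = 1`) of a matrix. -/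
def matSinc (X : Matrix ι ι ℂ) : Matrix ι ι ℂ :=
  ∑' k : ℕ, ((-1 : ℂ) ^ k / ((2 * k + 1).factorial : ℂ)) • X ^ (2 * k)

/-- The function `tanc z = tan z / z = sinc z / cos z` of a matrix. -/
def matTanc (X : Matrix ι ι ℂ) : Matrix ι ι ℂ := matSinc X * (matCos X)⁻¹

/-- The entire function `φ(u) = (exp u - 1) / u` (with `φ(0) = 1`) of a matrix. -/
def matPhi (X : Matrix ι ι ℂ) : Matrix ι ι ℂ :=
  ∑' k : ℕ, (1 / ((k + 1).factorial : ℂ)) • X ^ k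

end MatrixFunctions

/-- The Frobenius inner product of complex matrices. -/
def frobInner {ι κ : Type*} [Fintype ι] [Fintype κ] (X Y : Matrix ι κ ℂ) : ℂ :=
  (Xᴴ * Y).trace

/-- The Frobenius norm of a complex matrix. -/
def frobNorm {ι κ : Type*} [Fintype ι] [Fintype κ] (X : Matrix ι κ ℂ) : ℝ :=
  Real.sqrt (frobInner X X).re

/-! ### Spectral functions

In this section `F` stands for the value `F(iλ)` of the transfer matrix at a frequency `λ`. -/

section Spectral

variable {k₁ k₂ r : ℕ}

/-- `Φ = F F*` -/
def specΦ (F : Matrix (Fin r) (NoiseIdx k₁ k₂) ℂ) : Matrix (Fin r) (Fin r) ℂ := F * Fᴴ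

/-- `Ψ = F J F*` -/
def specΨ (F : Matrix (Fin r) (NoiseIdx k₁ k₂) ℂ) : Matrix (Fin r) (Fin r) ℂ :=
  F * noiseJC k₁ k₂ * Fᴴ

/-- `D_θ = cos(θ Ψ) - θ Φ sinc(θ Ψ)` -/
def specD (θ : ℝ) (F : Matrix (Fin r) (NoiseIdx k₁ k₂) ℂ) : Matrix (Fin r) (Fin r) ℂ :=
  matCos ((θ : ℂ) • specΨ F) - (θ : ℂ) • (specΦ F * matSinc ((θ : ℂ) • specΨ F))

/-- `φ(2iθΨ)` -/
def phiΨ (θ : ℝ) (F : Matrix (Fin r) (NoiseIdx k₁ k₂) ℂ) : Matrix (Fin r) (Fin r) ℂ :=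
  matPhi ((2 * Complex.I * (θ : ℂ)) • specΨ F)

/-- `Σ_θ = S F* φ(2iθΨ) F S` -/
def specSigma (θ : ℝ) (F : Matrix (Fin r) (NoiseIdx k₁ k₂) ℂ) :
    Matrix (NoiseIdx k₁ k₂) (NoiseIdx k₁ k₂) ℂ :=
  itoRoot k₁ k₂ * Fᴴ * phiΨ θ F * F * itoRoot k₁ k₂

/-- `Δ_θ = I - θ Σ_θ` -/
def specDelta (θ : ℝ) (F : Matrix (Fin r) (NoiseIdx k₁ k₂) ℂ) :
    Matrix (NoiseIdx k₁ k₂) (NoiseIdx k₁ k₂) ℂ :=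
  1 - (θ : ℂ) • specSigma θ F

/-- `S Δ_θ⁻¹ S` -/
def specSDS (θ : ℝ) (F : Matrix (Fin r) (NoiseIdx k₁ k₂) ℂ) :
    Matrix (NoiseIdx k₁ k₂) (NoiseIdx k₁ k₂) ℂ :=
  itoRoot k₁ k₂ * (specDelta θ F)⁻¹ * itoRoot k₁ k₂

/-- `ϖ_θ`, the bottom left block of `φ [[2iθΨ, 0], [F S Δ_θ⁻¹ S F*, 2iθΨ]]` -/
def specVarpi (θ : ℝ) (F : Matrix (Fin r) (NoiseIdx k₁ k₂) ℂ) : Matrix (Fin r) (Fin r) ℂ :=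
  (matPhi (Matrix.fromBlocks
    ((2 * Complex.I * (θ : ℂ)) • specΨ F) 0
    (F * specSDS θ F * Fᴴ) ((2 * Complex.I * (θ : ℂ)) • specΨ F))).toBlocks₂₁

/-- The weighting operator
`𝔐_{θ,F} : X ↦ φ(2iθΨ) X (S Δ_θ⁻¹ S) + ϖ_θ X (2iθJ)` at a fixed frequency. -/
def weighting (θ : ℝ) (F : Matrix (Fin r) (NoiseIdx k₁ k₂) ℂ) :
    Matrix (Fin r) (NoiseIdx k₁ k₂) ℂ →ₗ[ℂ] Matrix (Fin r) (NoiseIdx k₁ k₂) ℂ where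
  toFun X := phiΨ θ F * X * specSDS θ F
    + specVarpi θ F * X * ((2 * Complex.I * (θ : ℂ)) • noiseJC k₁ k₂)
  map_add' X Y := by
    simp only [Matrix.mul_add, Matrix.add_mul]
    abel
  map_smul' c X := by
    simp only [Matrix.mul_smul, Matrix.smul_mul, smul_add, RingHom.id_apply]
    rw [smul_comm]

end Spectral

/-! ### Cost functionals -/

section Costs

variable {n ν k₁ k₂ r : ℕ}

/-- The transfer matrix `F(s) = 𝒞 (s I - 𝒜)⁻¹ ℬ`. -/
def transfer (Γ : LoopMatrices n ν k₁ k₂ r) (s : ℂ) : Matrix (Fin r) (NoiseIdx k₁ k₂) ℂ :=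
  Γ.2.2.map Complex.ofReal * (s • (1 : Matrix (Fin n ⊕ Fin ν) (Fin n ⊕ Fin ν) ℂ)
    - Γ.1.map Complex.ofReal)⁻¹ * Γ.2.1.map Complex.ofReal

/-- The value `F(iλ)` of the transfer matrix at the frequency `λ`. -/
def freq (Γ : LoopMatrices n ν k₁ k₂ r) (l : ℝ) : Matrix (Fin r) (NoiseIdx k₁ k₂) ℂ :=
  transfer Γ (Complex.I * (l : ℂ))

/-- The logarithm of `det D_θ(λ)` (a positive real number under the spectral constraint). -/
def logDetD (θ : ℝ) (Γ : LoopMatrices n ν k₁ k₂ r) (l : ℝ) : ℝ :=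
  Real.log (specD θ (freq Γ l)).det.re

/-- The growth rate of the quadratic-exponential functional,
`Υ_θ = -(1/4π) ∫ log det D_θ(λ) dλ`. -/
def qefRate (θ : ℝ) (Γ : LoopMatrices n ν k₁ k₂ r) : ℝ :=
  -(1 / (4 * Real.pi)) * ∫ l : ℝ, logDetD θ Γ l

/-- The integrand `⟨F(iλ), 𝔐_λ(F(iλ))⟩` of the weighted quadratic cost. -/
def weightedDensity
    (𝔐 : ℝ → Matrix (Fin r) (NoiseIdx k₁ k₂) ℂ →ₗ[ℂ] Matrix (Fin r) (NoiseIdx k₁ k₂) ℂ)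
    (Γ : LoopMatrices n ν k₁ k₂ r) (l : ℝ) : ℂ :=
  frobInner (freq Γ l) (𝔐 l (freq Γ l))

/-- The weighted quadratic cost `V = (1/4π) ∫ ⟨F, 𝔐(F)⟩ dλ` with a given frequency-dependent
operator `𝔐` (the integral is real if `𝔐` is self-adjoint). -/
def weightedCost
    (𝔐 : ℝ → Matrix (Fin r) (NoiseIdx k₁ k₂) ℂ →ₗ[ℂ] Matrix (Fin r) (NoiseIdx k₁ k₂) ℂ)
    (Γ : LoopMatrices n ν k₁ k₂ r) : ℝ :=
  1 / (4 * Real.pi) * (∫ l : ℝ, weightedDensity 𝔐 Γ l).re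

/-! ### Admissible controllers -/

/-- Internal stability: all eigenvalues of `𝒜` lie in the open left half-plane. -/
def IsHurwitz (Γ : LoopMatrices n ν k₁ k₂ r) : Prop :=
  ∀ μ ∈ spectrum ℂ (Γ.1.map Complex.ofReal), μ.re < 0

/-- The two-point commutator kernel `Λ(τ)` of the criterion process. -/
def ccrKernel (Θ : Matrix (Fin n ⊕ Fin ν) (Fin n ⊕ Fin ν) ℝ) (Γ : LoopMatrices n ν k₁ k₂ r)
    (τ : ℝ) : Matrix (Fin r) (Fin r) ℝ :=
  Γ.2.2 * (if 0 ≤ τ then NormedSpace.exp (τ • Γ.1) * Θ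
    else Θ * NormedSpace.exp (-(τ • Γ.1ᵀ))) * Γ.2.2ᵀ

/-- Complete noncommutativity: for all sufficiently large `T`, the integral operator on
`L²([0, T], ℂ^r)` with the kernel `Λ(s - t)` has no nontrivial kernel. -/
def CompletelyNoncommutative (Θ : Matrix (Fin n ⊕ Fin ν) (Fin n ⊕ Fin ν) ℝ)
    (Γ : LoopMatrices n ν k₁ k₂ r) : Prop :=
  ∀ᶠ T : ℝ in atTop, ∀ f : ℝ → Fin r → ℂ,
    MemLp f 2 (volume.restrict (Set.Icc 0 T)) →
    (∀ᵐ s ∂(volume.restrict (Set.Icc 0 T)),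
      ∫ t in Set.Icc 0 T, (ccrKernel Θ Γ (s - t)).map Complex.ofReal *ᵥ f t = 0) →
    f =ᵐ[volume.restrict (Set.Icc 0 T)] 0

/-- The spectral constraint `θ sup_λ λ_max(Φ(λ) tanc(θΨ(λ))) < 1`. (The eigenvalues of the
product of positive semi-definite matrices `Φ`, `tanc(θΨ)` are real.) -/
def SpectralConstraint (θ : ℝ) (Γ : LoopMatrices n ν k₁ k₂ r) : Prop :=
  ∃ ρ : ℝ, ρ < 1 ∧ ∀ l μ : ℝ,
    (μ : ℂ) ∈ spectrum ℂ (specΦ (freq Γ l) * matTanc ((θ : ℂ) • specΨ (freq Γ l))) →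
      θ * μ ≤ ρ

/-- Admissible controllers for the risk-sensitive control problem with parameter `θ`. -/
structure Admissible {q₁ q₂ : ℕ} (P : Setup n ν k₁ k₂ q₁ q₂ r) (θ : ℝ)
    (ε : Energetics ν k₂ q₁) : Prop where
  hurwitz : IsHurwitz (P.closedLoop ε)
  noncommutative : CompletelyNoncommutative P.Θ (P.closedLoop ε)
  spectral : SpectralConstraint θ (P.closedLoop ε)

end Costs

/-! ### Frechet derivatives and stationarity -/

/-- The Frechet derivative of a scalar function of a real matrix, as a matrix `∂f` with
`δf = ⟨∂f, δX⟩` in the Frobenius inner product (whenever `f` is differentiable). -/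
def matGrad {ι κ : Type*} [Fintype ι] [Fintype κ] [DecidableEq ι] [DecidableEq κ]
    (f : Matrix ι κ ℝ → ℝ) (X : Matrix ι κ ℝ) : Matrix ι κ ℝ :=
  Matrix.of fun i j => fderiv ℝ f X (Matrix.single i j 1)

section Stationarity

variable {n ν k₁ k₂ q₁ q₂ r : ℕ}

/-- The triple of the partial Frechet derivatives of a cost with respect to `𝒜`, `ℬ`, `𝒞`
(the nontrivial blocks of `∂_Γ`). -/
def loopGrad (cost : LoopMatrices n ν k₁ k₂ r → ℝ) (Γ : LoopMatrices n ν k₁ k₂ r) :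
    LoopMatrices n ν k₁ k₂ r :=
  (matGrad (fun X => cost (X, Γ.2.1, Γ.2.2)) Γ.1,
    matGrad (fun X => cost (Γ.1, X, Γ.2.2)) Γ.2.1,
    matGrad (fun X => cost (Γ.1, Γ.2.1, X)) Γ.2.2)

/-- The quadruple of the partial Frechet derivatives of a cost with respect to the controller
matrices `a`, `b`, `c`, `e` as independent variables. -/
def ctrlGrad (P : Setup n ν k₁ k₂ q₁ q₂ r) (cost : LoopMatrices n ν k₁ k₂ r → ℝ)
    (γ : CtrlMatrices ν k₂ q₁ q₂) : CtrlMatrices ν k₂ q₁ q₂ :=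
  (matGrad (fun X => cost (P.loop (X, γ.2.1, γ.2.2.1, γ.2.2.2))) γ.1,
    matGrad (fun X => cost (P.loop (γ.1, X, γ.2.2.1, γ.2.2.2))) γ.2.1,
    matGrad (fun X => cost (P.loop (γ.1, γ.2.1, X, γ.2.2.2))) γ.2.2.1,
    matGrad (fun X => cost (P.loop (γ.1, γ.2.1, γ.2.2.1, X))) γ.2.2.2)

/-- symmetric part of a square matrix -/
def symPart {ι : Type*} (X : Matrix ι ι ℝ) : Matrix ι ι ℝ := (1 / 2 : ℝ) • (X + Xᵀ)

/-- antisymmetric part of a square matrix -/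
def antisymPart {ι : Type*} (X : Matrix ι ι ℝ) : Matrix ι ι ℝ := (1 / 2 : ℝ) • (X - Xᵀ)

/-- The first-order optimality conditions for a cost functional at the controller with the
energy and coupling matrices `ε = (R₂, M₂, L₂)`; here `g` is the quadruple
`(∂_a, ∂_b, ∂_c, ∂_e)` of partial Frechet derivatives of the cost. -/
def IsStationaryController (P : Setup n ν k₁ k₂ q₁ q₂ r) (cost : LoopMatrices n ν k₁ k₂ r → ℝ)
    (ε : Energetics ν k₂ q₁) : Prop :=
  let g := ctrlGrad P cost (P.ctrl ε)
  symPart (P.Θ₂ * g.1) = 0 ∧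
  (2 : ℝ) • (fieldJ k₂ * ε.2.1 * antisymPart (P.Θ₂ * g.1)) + g.2.1ᵀ * P.Θ₂
    - fieldJ k₂ * P.dᵀ * g.2.2.1 = 0 ∧
  (2 : ℝ) • (P.Jt₁ * ε.2.2 * antisymPart (P.Θ₂ * g.1)) + g.2.2.2ᵀ * P.Θ₂ = 0

end Stationarity

end CQRS

end

open CQRS

/-! Both costs integrate, over the frequency, a function of the value F = F(iλ). The gradients of
the two integrands in F are proportional at the given controller, and everything else follows by the
chain rule.

Sylvester's determinant identity and S² = I - iJ turn det Δ_θ into det(1 - θ(Φ - iΨ) φ(2iθΨ)). With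
H = iθΨ Hermitian, φ(2H) = sinhc(H) e^H and 1 + H φ(2H) = cosh(H) e^H, so this determinant is det
D_θ · exp(iθ Tr Ψ) (`det_specDelta`). Since F(-λ) is the complex conjugate of F(λ), Tr Ψ is odd in λ
(`trace_specΨ_freq_neg`) and integrates to zero. Hence ln det Δ_θ may replace ln det D_θ in Υ_θ.

By Jacobi's formula the variation of ln det Δ_θ is a trace with three terms, from δF*, δφ and δF.
The derivative of φ is an upper right block of φ of a block triangular matrix, and under the trace
it is dual to the lower left block that defines ϖ_θ (`trace_mul_fderiv_matPhi`). The terms combine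
into -2θ Re⟨δF, 𝔐_{θ,F}(F)⟩ (`hasFDerivAt_log_det_specDelta`). For a frozen self-adjoint 𝔐, the
variation of ⟨F, 𝔐(F)⟩ is 2 Re⟨δF, 𝔐(F)⟩. With the prefactors -1/4π and 1/4π, the derivative of Υ_θ
is θ times that of V.

Differentiation under the integral needs bounds uniform in λ. The spectral constraint gives det Δ_θ
> 0 along the frequency response. The response tends to 0 at infinity, so for all nearby systems it
stays in one compact subset K of the domain det Δ_θ > 0 (`exists_isCompact_freq_mem`). On K the
integrands are O(‖F‖²) and their gradients O(‖F‖), while F and its derivative in (𝒜, ℬ, 𝒞) are O((1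
+ λ²)^{-1/2}). The products are therefore dominated by a multiple of 1/(1 + λ²)
(`hasFDerivAt_integral_freq`, `costs_near`). -/

namespace CQRS

section FrobeniusTopology

open scoped Matrix.Norms.Frobenius
-- With the entrywise instances removed, the only topology that instance search finds on matrices is
-- that of the Frobenius norm, which is submultiplicative also for rectangular factors.
attribute [-instance] instTopologicalSpaceMatrix Matrix.instUniformSpace

/-! ### Matrix calculus in the Frobenius norm -/

section Blocks

variable {ι κ : Type*}

/-- The extraction of the top right block. -/
def blockUR (ι κ : Type*) : Matrix (ι ⊕ κ) (ι ⊕ κ) ℂ →ₗ[ℂ] Matrix ι κ ℂ where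
  toFun M := M.toBlocks₁₂
  map_add' _ _ := rfl
  map_smul' _ _ := rfl

/-- The extraction of the bottom left block. -/
def blockBL (ι κ : Type*) : Matrix (ι ⊕ κ) (ι ⊕ κ) ℂ →ₗ[ℂ] Matrix κ ι ℂ where
  toFun M := M.toBlocks₂₁
  map_add' _ _ := rfl
  map_smul' _ _ := rfl

@[simp]
theorem blockUR_apply (M : Matrix (ι ⊕ κ) (ι ⊕ κ) ℂ) : blockUR ι κ M = M.toBlocks₁₂ := rfl

@[simp]
theorem blockBL_apply (M : Matrix (ι ⊕ κ) (ι ⊕ κ) ℂ) : blockBL ι κ M = M.toBlocks₂₁ := rfl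

theorem blockUR_fromBlocks (A : Matrix ι ι ℂ) (B : Matrix ι κ ℂ) (C : Matrix κ ι ℂ)
    (D : Matrix κ κ ℂ) : blockUR ι κ (Matrix.fromBlocks A B C D) = B := rfl

end Blocks

section Calculus

variable {ι κ μ : Type*} [Fintype ι] [Fintype κ] [Fintype μ]

instance matrixCompleteSpace : CompleteSpace (Matrix ι κ ℂ) :=
  FiniteDimensional.complete ℝ _

theorem continuous_frobMul {α : Type*} [TopologicalSpace α] {f : α → Matrix ι κ ℂ}
    {g : α → Matrix κ μ ℂ} (hf : Continuous f) (hg : Continuous g) :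
    Continuous fun x => f x * g x :=
  Continuous.matrix_mul hf hg

/-- Matrix multiplication as a continuous bilinear map. -/
noncomputable def frobMulL (ι κ μ : Type*) [Fintype ι] [Fintype κ] [Fintype μ] :
    Matrix ι κ ℂ →L[ℝ] Matrix κ μ ℂ →L[ℝ] Matrix ι μ ℂ :=
  LinearMap.mkContinuous₂
    (LinearMap.mk₂ ℝ (fun A B => A * B) (fun _ _ _ => Matrix.add_mul _ _ _)
      (fun _ _ _ => Matrix.smul_mul _ _ _) (fun _ _ _ => Matrix.mul_add _ _ _)
      (fun _ _ _ => Matrix.mul_smul _ _ _)) 1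
    (fun A B => by
      rw [one_mul]
      exact Matrix.frobenius_norm_mul A B)

theorem frobMulL_apply (A : Matrix ι κ ℂ) (B : Matrix κ μ ℂ) : frobMulL ι κ μ A B = A * B := rfl

theorem hasFDerivAt_frobMul {E : Type*} [NormedAddCommGroup E] [NormedSpace ℝ E]
    {f : E → Matrix ι κ ℂ} {g : E → Matrix κ μ ℂ} {f' : E →L[ℝ] Matrix ι κ ℂ}
    {g' : E →L[ℝ] Matrix κ μ ℂ} {x : E} (hf : HasFDerivAt f f' x) (hg : HasFDerivAt g g' x) :
    HasFDerivAt (fun y => f y * g y)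
      ((frobMulL ι κ μ (f x)).comp g' + ((frobMulL ι κ μ).flip (g x)).comp f') x :=
  (frobMulL ι κ μ).hasFDerivAt_of_bilinear hf hg

theorem continuous_blockUR : Continuous (blockUR ι κ) :=
  LinearMap.continuous_of_finiteDimensional _

theorem continuous_blockBL : Continuous (blockBL ι κ) :=
  LinearMap.continuous_of_finiteDimensional _

end Calculus

/-! ### The function `φ` -/


section Phi

variable {ι κ : Type*} [Fintype ι] [DecidableEq ι] [Fintype κ] [DecidableEq κ]

theorem fromBlocks_one_pow_succ (X : Matrix ι ι ℂ) (k : ℕ) :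
    (Matrix.fromBlocks X 1 0 0 : Matrix (ι ⊕ ι) (ι ⊕ ι) ℂ) ^ (k + 1)
      = Matrix.fromBlocks (X ^ (k + 1)) (X ^ k) 0 0 := by
  induction k with
  | zero => simp
  | succ k ih =>
    rw [pow_succ, ih, Matrix.fromBlocks_multiply]
    simp [pow_succ]

/-- The upper right block of the (k+1)-th power of [[X, 1], [0, 0]] is X^k, so the exponential
series, shifted by one index, shows the series of φ in that block. -/
theorem hasSum_exp_fromBlocks (X : Matrix ι ι ℂ) :
    HasSum (fun k : ℕ => (1 / ((k + 1).factorial : ℂ)) • X ^ k)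
      (blockUR ι ι (NormedSpace.exp (Matrix.fromBlocks X 1 0 0))) := by
  have h := NormedSpace.exp_series_hasSum_exp' (𝕂 := ℂ)
    (Matrix.fromBlocks X 1 0 0 : Matrix (ι ⊕ ι) (ι ⊕ ι) ℂ)
  have h2 := h.map (blockUR ι ι) continuous_blockUR
  rw [← hasSum_nat_add_iff' 1] at h2
  have h0 : blockUR ι ι (1 : Matrix (ι ⊕ ι) (ι ⊕ ι) ℂ) = 0 := by
    rw [← Matrix.fromBlocks_one, blockUR_apply, Matrix.toBlocks_fromBlocks₁₂]
  simpa [Function.comp_def, -blockUR_apply, h0, fromBlocks_one_pow_succ, blockUR_fromBlocks]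
    using h2

theorem matPhi_eq_exp (X : Matrix ι ι ℂ) :
    matPhi X = blockUR ι ι (NormedSpace.exp (Matrix.fromBlocks X 1 0 0)) := by
  have h := (hasSum_exp_fromBlocks X).tsum_eq
  exact h

theorem hasSum_matPhi (X : Matrix ι ι ℂ) :
    HasSum (fun k : ℕ => (1 / ((k + 1).factorial : ℂ)) • X ^ k) (matPhi X) := by
  rw [matPhi_eq_exp]
  exact hasSum_exp_fromBlocks X

/-- `φ(X)` is a block of `exp [[X, 1], [0, 0]]`, hence differentiable in `X`. -/
theorem differentiable_matPhi : Differentiable ℝ (matPhi : Matrix ι ι ℂ → Matrix ι ι ℂ) := by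
  have e : (matPhi : Matrix ι ι ℂ → Matrix ι ι ℂ) =
      fun X => blockUR ι ι (NormedSpace.exp (Matrix.fromBlocks X 1 0 0)) := by
    funext X; exact matPhi_eq_exp X
  have h1 : Differentiable ℝ (fun X : Matrix ι ι ℂ =>
      (Matrix.fromBlocks X 1 0 0 : Matrix (ι ⊕ ι) (ι ⊕ ι) ℂ)) := by
    let L : Matrix ι ι ℂ →ₗ[ℝ] Matrix (ι ⊕ ι) (ι ⊕ ι) ℂ :=
      { toFun := fun X => Matrix.fromBlocks X 0 0 0
        map_add' := fun X Y => by simp [Matrix.fromBlocks_add]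
        map_smul' := fun c X => by simp [Matrix.fromBlocks_smul] }
    have : (fun X : Matrix ι ι ℂ => (Matrix.fromBlocks X 1 0 0 : Matrix (ι ⊕ ι) (ι ⊕ ι) ℂ)) =
        fun X => L X + Matrix.fromBlocks 0 1 0 0 := by
      funext X
      simp [L, Matrix.fromBlocks_add]
    rw [this]
    exact (LinearMap.toContinuousLinearMap L).differentiable.add_const _
  have h2 : Differentiable ℝ (NormedSpace.exp :
      Matrix (ι ⊕ ι) (ι ⊕ ι) ℂ → Matrix (ι ⊕ ι) (ι ⊕ ι) ℂ) := by
    intro x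
    exact (NormedSpace.exp_analytic (𝕂 := ℝ) x).differentiableAt
  have h3 : Differentiable ℝ (blockUR ι ι) :=
    (LinearMap.toContinuousLinearMap ((blockUR ι ι).restrictScalars ℝ)).differentiable
  rw [e]
  exact h3.comp (h2.comp h1)

theorem continuous_matPhi : Continuous (matPhi : Matrix ι ι ℂ → Matrix ι ι ℂ) :=
  differentiable_matPhi.continuous

/-- Only compatibility with the powers of X, including the zeroth, is needed, because φ is a power
series and `L` is continuous. Similarity and reindexing are both instances. -/
theorem matPhi_eq_of_intertwine (X : Matrix ι ι ℂ) (Y : Matrix κ κ ℂ)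
    (L : Matrix ι ι ℂ →ₗ[ℂ] Matrix κ κ ℂ) (h : ∀ k, L (X ^ k) = Y ^ k) :
    L (matPhi X) = matPhi Y := by
  have h1 := (hasSum_matPhi X).map L (LinearMap.continuous_of_finiteDimensional L)
  refine h1.unique ?_
  convert hasSum_matPhi Y using 2 with k
  simp [h]

theorem matPhi_conj (P Q X : Matrix ι ι ℂ) (hQP : Q * P = 1) :
    matPhi (P * X * Q) = P * matPhi X * Q := by
  let L : Matrix ι ι ℂ →ₗ[ℂ] Matrix ι ι ℂ :=
    (LinearMap.mulLeftRight ℂ (P, Q))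
  have hL : ∀ Y, L Y = P * Y * Q := fun Y => by simp [L]
  rw [← hL (matPhi X)]
  symm
  apply matPhi_eq_of_intertwine
  intro k
  have hPQ : P * Q = 1 := mul_eq_one_comm.mp hQP
  rw [hL]
  induction k with
  | zero => simp [hPQ]
  | succ k ih =>
    rw [pow_succ (P * X * Q), ← ih, pow_succ]
    calc P * (X ^ k * X) * Q = P * X ^ k * 1 * X * Q := by simp only [mul_assoc, one_mul]
      _ = P * X ^ k * (Q * P) * X * Q := by rw [hQP]
      _ = _ := by simp only [mul_assoc]

theorem matPhi_conjTranspose (X : Matrix ι ι ℂ) : (matPhi X)ᴴ = matPhi Xᴴ := by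
  have h := (hasSum_matPhi X).map (Matrix.conjTransposeAddEquiv ι ι ℂ).toAddMonoidHom
    (by
      have : Continuous fun M : Matrix ι ι ℂ => Mᴴ := Continuous.matrix_conjTranspose continuous_id
      exact this)
  refine h.unique ?_
  convert hasSum_matPhi Xᴴ using 2 with k
  simp [Matrix.conjTranspose_smul, Matrix.conjTranspose_pow]

theorem matPhi_reindex (e : ι ≃ κ) (X : Matrix ι ι ℂ) :
    Matrix.reindexAlgEquiv ℂ ℂ e (matPhi X) = matPhi (Matrix.reindexAlgEquiv ℂ ℂ e X) :=
  matPhi_eq_of_intertwine X _ (Matrix.reindexAlgEquiv ℂ ℂ e).toLinearMap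
    (fun k => map_pow (Matrix.reindexAlgEquiv ℂ ℂ e) X k)

theorem matPhi_fromBlocks_diagonal (X : Matrix ι ι ℂ) (Y : Matrix κ κ ℂ) :
    matPhi (Matrix.fromBlocks X 0 0 Y) = Matrix.fromBlocks (matPhi X) 0 0 (matPhi Y) := by
  have hp : ∀ k, (Matrix.fromBlocks X 0 0 Y) ^ k = Matrix.fromBlocks (X ^ k) 0 0 (Y ^ k) := by
    intro k
    induction k with
    | zero => simp
    | succ k ih => rw [pow_succ, ih, Matrix.fromBlocks_multiply]; simp [pow_succ]
  -- The corner embeddings are not unital, so neither intertwines powers by itself; the two embedded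
  -- series are added instead.
  let L₁ : Matrix ι ι ℂ →ₗ[ℂ] Matrix (ι ⊕ κ) (ι ⊕ κ) ℂ :=
    { toFun := fun X => Matrix.fromBlocks X 0 0 0
      map_add' := fun X Y => by simp [Matrix.fromBlocks_add]
      map_smul' := fun c X => by simp [Matrix.fromBlocks_smul] }
  let L₂ : Matrix κ κ ℂ →ₗ[ℂ] Matrix (ι ⊕ κ) (ι ⊕ κ) ℂ :=
    { toFun := fun X => Matrix.fromBlocks 0 0 0 X
      map_add' := fun X Y => by simp [Matrix.fromBlocks_add]
      map_smul' := fun c X => by simp [Matrix.fromBlocks_smul] }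
  have h1 := (hasSum_matPhi X).map L₁ (LinearMap.continuous_of_finiteDimensional L₁)
  have h2 := (hasSum_matPhi Y).map L₂ (LinearMap.continuous_of_finiteDimensional L₂)
  have h3 := (h1.add h2).unique (a₂ := matPhi (Matrix.fromBlocks X 0 0 Y)) (by
    convert hasSum_matPhi (Matrix.fromBlocks X 0 0 Y) using 2 with k
    simp [hp, L₁, L₂, Matrix.fromBlocks_add, Matrix.fromBlocks_smul])
  rw [← h3]
  simp [L₁, L₂, Matrix.fromBlocks_add]

/-- Divided differences of `φ` in terms of block triangular matrices. -/
theorem blockUR_matPhi_add_smul (X V : Matrix ι ι ℂ) {t : ℝ} (ht : t ≠ 0) :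
    blockUR ι ι (matPhi (Matrix.fromBlocks X V 0 (X + t • V)))
      = t⁻¹ • (matPhi (X + t • V) - matPhi X) := by
  set Y := X + t • V with hY
  have hV : V = t⁻¹ • (Y - X) := by
    rw [hY, add_sub_cancel_left, smul_smul, inv_mul_cancel₀ ht, one_smul]
  -- As V is a multiple of Y - X, the unipotent matrix with corner t⁻¹ block-diagonalizes the
  -- triangular one.
  have e : Matrix.fromBlocks X V 0 Y =
      (Matrix.fromBlocks 1 (t⁻¹ • 1) 0 1 : Matrix (ι ⊕ ι) (ι ⊕ ι) ℂ)
        * Matrix.fromBlocks X 0 0 Y * Matrix.fromBlocks 1 (-(t⁻¹ • 1)) 0 1 := by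
    rw [Matrix.fromBlocks_multiply, Matrix.fromBlocks_multiply]
    simp only [hV, Matrix.one_mul, Matrix.mul_one, Matrix.mul_zero, Matrix.zero_mul, add_zero,
      zero_add, Matrix.mul_neg, Matrix.mul_smul, Matrix.smul_mul, smul_add, smul_neg, smul_zero,
      neg_zero, sub_eq_neg_add]
  rw [e, matPhi_conj, matPhi_fromBlocks_diagonal, Matrix.fromBlocks_multiply,
    Matrix.fromBlocks_multiply]
  · simp [-blockUR_apply, blockUR_fromBlocks, smul_add, sub_eq_neg_add]
  · rw [Matrix.fromBlocks_multiply]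
    simp

/-- The limit t → 0 of the divided difference identity; continuity of φ gives the limit of the
block. -/
theorem fderiv_matPhi_apply (X V : Matrix ι ι ℂ) :
    fderiv ℝ matPhi X V = blockUR ι ι (matPhi (Matrix.fromBlocks X V 0 X)) := by
  have h1 : Tendsto (fun t : ℝ => t⁻¹ • (matPhi (X + t • V) - matPhi X)) (𝓝[≠] 0)
      (𝓝 (fderiv ℝ matPhi X V)) := by
    have := ((differentiable_matPhi X).hasFDerivAt.hasLineDerivAt V).tendsto_slope_zero
    simpa using this
  have h2 : Tendsto (fun t : ℝ => blockUR ι ι (matPhi (Matrix.fromBlocks X V 0 (X + t • V))))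
      (𝓝[≠] 0) (𝓝 (blockUR ι ι (matPhi (Matrix.fromBlocks X V 0 X)))) := by
    have hc : Continuous fun t : ℝ =>
        blockUR ι ι (matPhi (Matrix.fromBlocks X V 0 (X + t • V))) := by
      refine continuous_blockUR.comp (continuous_matPhi.comp ?_)
      have h : Continuous fun t : ℝ => X + t • V := by fun_prop
      exact Continuous.matrix_fromBlocks continuous_const continuous_const continuous_const h
    have := (hc.tendsto 0).mono_left (nhdsWithin_le_nhds (s := {0}ᶜ))
    simpa using this
  refine tendsto_nhds_unique (h1.congr' ?_) h2
  filter_upwards [self_mem_nhdsWithin] with t ht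
  exact (blockUR_matPhi_add_smul X V ht).symm

/-- The truncated subtraction is harmless: i < k in every term, and the sum is empty for k = 0. -/
theorem fromBlocks_upper_pow (X V : Matrix ι ι ℂ) (k : ℕ) :
    (Matrix.fromBlocks X V 0 X) ^ k = Matrix.fromBlocks (X ^ k)
      (∑ i ∈ Finset.range k, X ^ i * V * X ^ (k - 1 - i)) 0 (X ^ k) := by
  induction k with
  | zero => simp
  | succ k ih =>
    rw [pow_succ', ih, Matrix.fromBlocks_multiply]
    congr 1
    · simp [pow_succ']
    · rw [Finset.sum_range_succ', Finset.mul_sum]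
      simp only [pow_zero, Matrix.one_mul, Nat.add_sub_cancel, Nat.sub_zero]
      congr 1
      refine Finset.sum_congr rfl fun i _ => ?_
      rw [pow_succ', Nat.sub_sub, Nat.add_comm 1 i]
      simp only [Matrix.mul_assoc]
    · simp
    · simp [pow_succ']

theorem fromBlocks_lower_pow (X G : Matrix ι ι ℂ) (k : ℕ) :
    (Matrix.fromBlocks X 0 G X) ^ k = Matrix.fromBlocks (X ^ k) 0
      (∑ i ∈ Finset.range k, X ^ (k - 1 - i) * G * X ^ i) (X ^ k) := by
  induction k with
  | zero => simp
  | succ k ih =>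
    rw [pow_succ, ih, Matrix.fromBlocks_multiply]
    congr 1
    · simp [pow_succ]
    · simp
    · rw [Finset.sum_range_succ', Finset.sum_mul, add_comm]
      simp only [pow_zero, Matrix.mul_one, Nat.add_sub_cancel, Nat.sub_zero]
      rw [add_comm]
      congr 1
      refine Finset.sum_congr rfl fun i _ => ?_
      rw [pow_succ, Nat.sub_sub, Nat.add_comm 1 i]
      simp only [Matrix.mul_assoc]
    · simp [pow_succ]

/-- The derivative of `φ` is dual to the bottom left block of `φ` of a block matrix. -/
theorem trace_mul_fderiv_matPhi (X G V : Matrix ι ι ℂ) :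
    (G * fderiv ℝ matPhi X V).trace
      = ((matPhi (Matrix.fromBlocks X 0 G X)).toBlocks₂₁ * V).trace := by
  rw [fderiv_matPhi_apply]
  let L₁ : Matrix (ι ⊕ ι) (ι ⊕ ι) ℂ →ₗ[ℂ] ℂ :=
    Matrix.traceLinearMap ι ℂ ℂ ∘ₗ LinearMap.mulLeft ℂ G ∘ₗ blockUR ι ι
  let L₂ : Matrix (ι ⊕ ι) (ι ⊕ ι) ℂ →ₗ[ℂ] ℂ :=
    Matrix.traceLinearMap ι ℂ ℂ ∘ₗ LinearMap.mulRight ℂ V ∘ₗ blockBL ι ι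
  have h1 := (hasSum_matPhi (Matrix.fromBlocks X V 0 X)).map L₁
    (LinearMap.continuous_of_finiteDimensional L₁)
  have h2 := (hasSum_matPhi (Matrix.fromBlocks X 0 G X)).map L₂
    (LinearMap.continuous_of_finiteDimensional L₂)
  -- For each power both traces equal Σ_i Tr(G X^i V X^{k-1-i}), up to a cyclic shift.
  suffices h3 : (fun k => L₁ ((1 / ((k + 1).factorial : ℂ)) • Matrix.fromBlocks X V 0 X ^ k))
      = fun k => L₂ ((1 / ((k + 1).factorial : ℂ)) • Matrix.fromBlocks X 0 G X ^ k) by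
    exact h1.unique ((congrArg (fun f => HasSum f _) h3).mpr h2)
  funext k
  rw [map_smul, map_smul]
  congr 1
  simp only [L₁, L₂, LinearMap.comp_apply, fromBlocks_upper_pow, fromBlocks_lower_pow,
    blockUR_apply, blockBL_apply, Matrix.toBlocks_fromBlocks₁₂,
    Matrix.toBlocks_fromBlocks₂₁, LinearMap.mulLeft_apply, LinearMap.mulRight_apply,
    Matrix.traceLinearMap_apply, Finset.mul_sum, Finset.sum_mul, Matrix.trace_sum]
  refine Finset.sum_congr rfl fun i _ => ?_
  rw [← Matrix.mul_assoc, ← Matrix.mul_assoc, Matrix.trace_mul_comm]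
  simp only [Matrix.mul_assoc]

/-- The adjoint makes the lower triangular matrix upper triangular, and swapping the two summands of
the index type makes it lower triangular again, with the same blocks. Applied below to ϖ_θ. -/
theorem matPhi_lower_conjTranspose {X G : Matrix ι ι ℂ} (hX : Xᴴ = X) (hG : Gᴴ = G) :
    ((matPhi (Matrix.fromBlocks X 0 G X)).toBlocks₂₁)ᴴ
      = (matPhi (Matrix.fromBlocks X 0 G X)).toBlocks₂₁ := by
  have h1 := matPhi_conjTranspose (Matrix.fromBlocks X 0 G X)
  rw [Matrix.fromBlocks_conjTranspose, hX, hG, Matrix.conjTranspose_zero] at h1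
  have h2 := matPhi_reindex (Equiv.sumComm ι ι) (Matrix.fromBlocks X G 0 X)
  have h3 : Matrix.reindexAlgEquiv ℂ ℂ (Equiv.sumComm ι ι) (Matrix.fromBlocks X G 0 X)
      = Matrix.fromBlocks X 0 G X := by
    ext i j
    rcases i with i | i <;> rcases j with j | j <;> rfl
  rw [h3, ← h1] at h2
  ext i j
  have := congrFun (congrFun h2 (Sum.inr i)) (Sum.inl j)
  exact this

end Phi

/-! ### Functions of diagonalizable matrices -/

/-- The function `sinh x / x`, extended by continuity. -/
noncomputable def sinhc (x : ℝ) : ℝ := if x = 0 then 1 else Real.sinh x / x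

theorem sinhc_mul_self (x : ℝ) : sinhc x * x = Real.sinh x := by
  unfold sinhc
  split_ifs with h
  · simp [h]
  · field_simp

theorem sinhc_pos (x : ℝ) : 0 < sinhc x := by
  unfold sinhc
  split_ifs with h
  · exact one_pos
  · rcases lt_or_gt_of_ne h with h | h
    · exact div_pos_of_neg_of_neg (Real.sinh_neg_iff.mpr h) h
    · exact div_pos (Real.sinh_pos_iff.mpr h) h

theorem hasSum_sinhc (x : ℝ) :
    HasSum (fun k : ℕ => x ^ (2 * k) / ((2 * k + 1).factorial : ℝ)) (sinhc x) := by
  unfold sinhc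
  split_ifs with h
  · convert hasSum_ite_eq (0 : ℕ) (1 : ℝ) using 2 with k
    rcases k with _ | k <;> simp [h]
  · refine (congrArg (fun f => HasSum f _) (funext fun k => ?_)).mp
      ((Real.hasSum_sinh x).div_const x)
    rw [pow_succ]
    field_simp

/-- The scalar identity φ(2x) = (e^{2x} - 1)/(2x) = e^x sinh(x)/x, in the form of a power series. -/
theorem hasSum_exp_mul_sinhc (x : ℝ) :
    HasSum (fun k : ℕ => 1 / ((k + 1).factorial : ℝ) * (2 * x) ^ k) (Real.exp x * sinhc x) := by
  unfold sinhc
  split_ifs with h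
  · convert hasSum_ite_eq (0 : ℕ) (Real.exp x * 1) using 2 with k
    rcases k with _ | k <;> simp [h]
  · have h1 : HasSum (fun k : ℕ => (2 * x) ^ k / (k.factorial : ℝ)) (Real.exp (2 * x)) := by
      rw [Real.exp_eq_exp_ℝ]
      exact NormedSpace.expSeries_div_hasSum_exp (2 * x)
    rw [← hasSum_nat_add_iff' 1] at h1
    have h2 : Real.exp x * (Real.sinh x / x)
        = (Real.exp (2 * x) - ∑ i ∈ Finset.range 1, (2 * x) ^ i / (i.factorial : ℝ)) / (2 * x) := by
      rw [Real.sinh_eq, two_mul, Real.exp_add]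
      simp only [Finset.range_one, Finset.sum_singleton, pow_zero, Nat.factorial_zero,
        Nat.cast_one, div_one]
      have : Real.exp x * Real.exp (-x) = 1 := by rw [← Real.exp_add]; simp
      field_simp
      linear_combination -2 * this
    rw [h2]
    refine (congrArg (fun f => HasSum f _) (funext fun k => ?_)).mp
      (h1.div_const (2 * x))
    rw [pow_succ]
    field_simp

section Diagonalizable

variable {ι : Type*} [Fintype ι] [DecidableEq ι] (P Q : Matrix ι ι ℂ)

/-- The linear map `f ↦ P * diagonal f * Q`. -/
noncomputable def conjDiag : (ι → ℂ) →ₗ[ℂ] Matrix ι ι ℂ :=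
  LinearMap.mulLeftRight ℂ (P, Q) ∘ₗ Matrix.diagonalLinearMap ι ℂ ℂ

theorem conjDiag_apply (f : ι → ℂ) : conjDiag P Q f = P * Matrix.diagonal f * Q := rfl

variable {P Q}

/-- Together with `conjDiag_one` this makes `conjDiag P Q` a unital algebra homomorphism, which
reduces identities between functions of one diagonalizable matrix to scalar ones. -/
theorem conjDiag_mul (h : Q * P = 1) (f g : ι → ℂ) :
    conjDiag P Q f * conjDiag P Q g = conjDiag P Q (f * g) := by
  simp only [conjDiag_apply]
  calc P * Matrix.diagonal f * Q * (P * Matrix.diagonal g * Q)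
      = P * Matrix.diagonal f * (Q * P) * Matrix.diagonal g * Q := by simp only [mul_assoc]
    _ = P * (Matrix.diagonal f * Matrix.diagonal g) * Q := by rw [h]; simp only [mul_assoc, mul_one]
    _ = _ := by rw [Matrix.diagonal_mul_diagonal]; rfl

theorem conjDiag_one (h : Q * P = 1) : conjDiag P Q 1 = 1 := by
  have : P * Q = 1 := mul_eq_one_comm.mp h
  rw [conjDiag_apply, show Matrix.diagonal (1 : ι → ℂ) = 1 from Matrix.diagonal_one, mul_one, this]

theorem conjDiag_pow (h : Q * P = 1) (f : ι → ℂ) (k : ℕ) :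
    conjDiag P Q f ^ k = conjDiag P Q (f ^ k) := by
  induction k with
  | zero => rw [pow_zero, pow_zero, conjDiag_one h]
  | succ k ih => rw [pow_succ, ih, conjDiag_mul h, pow_succ]

theorem det_conjDiag (h : Q * P = 1) (f : ι → ℂ) : (conjDiag P Q f).det = ∏ i, f i := by
  rw [conjDiag_apply, Matrix.det_mul_comm, ← mul_assoc, h, one_mul, Matrix.det_diagonal]

theorem trace_conjDiag (h : Q * P = 1) (f : ι → ℂ) : (conjDiag P Q f).trace = ∑ i, f i := by
  rw [conjDiag_apply, Matrix.trace_mul_comm, ← mul_assoc, h, one_mul, Matrix.trace_diagonal]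

theorem conjTranspose_conjDiag (h : Pᴴ = Q) (f : ι → ℝ) :
    (conjDiag P Q fun i => (f i : ℂ))ᴴ = conjDiag P Q fun i => (f i : ℂ) := by
  subst h
  simp only [conjDiag_apply, Matrix.conjTranspose_mul, Matrix.conjTranspose_conjTranspose,
    Matrix.diagonal_conjTranspose, mul_assoc]
  congr 3
  funext i
  simp

/-- The exponents `n k` are free so that the even series of cos and sinc and the full series of φ
are covered at once. -/
theorem hasSum_smul_conjDiag_pow (h : Q * P = 1) (d f : ι → ℂ) (c : ℕ → ℂ) (n : ℕ → ℕ)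
    (hf : ∀ i, HasSum (fun k => c k * d i ^ n k) (f i)) :
    HasSum (fun k => c k • conjDiag P Q d ^ n k) (conjDiag P Q f) := by
  have h1 : HasSum (fun k i => c k * d i ^ n k) f := Pi.hasSum.2 hf
  have h2 := h1.map (conjDiag P Q) (LinearMap.continuous_of_finiteDimensional _)
  convert h2 using 2 with k
  rw [conjDiag_pow h, ← map_smul]
  rfl

theorem neg_I_mul_pow_two_mul (x : ℂ) (k : ℕ) :
    (-Complex.I * x) ^ (2 * k) = (-1) ^ k * x ^ (2 * k) := by
  rw [mul_pow, pow_mul (-Complex.I), neg_sq, Complex.I_sq]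

theorem matCos_conjDiag (h : Q * P = 1) (x : ι → ℝ) :
    matCos (conjDiag P Q fun i => -Complex.I * x i)
      = conjDiag P Q fun i => (Real.cosh (x i) : ℂ) := by
  refine (hasSum_smul_conjDiag_pow h _ _ (fun k => (-1 : ℂ) ^ k / ((2 * k).factorial : ℂ))
    (fun k => 2 * k) fun i => ?_).tsum_eq
  convert (Complex.hasSum_ofReal.mpr (Real.hasSum_cosh (x i))) using 2 with k
  rw [neg_I_mul_pow_two_mul]
  push_cast
  have : ((-1 : ℂ) ^ k) * (-1) ^ k = 1 := by rw [← mul_pow]; simp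
  linear_combination ((x i : ℂ) ^ (2 * k) / ((2 * k).factorial : ℂ)) * this

theorem matSinc_conjDiag (h : Q * P = 1) (x : ι → ℝ) :
    matSinc (conjDiag P Q fun i => -Complex.I * x i)
      = conjDiag P Q fun i => (sinhc (x i) : ℂ) := by
  refine (hasSum_smul_conjDiag_pow h _ _ (fun k => (-1 : ℂ) ^ k / ((2 * k + 1).factorial : ℂ))
    (fun k => 2 * k) fun i => ?_).tsum_eq
  convert (Complex.hasSum_ofReal.mpr (hasSum_sinhc (x i))) using 2 with k
  rw [neg_I_mul_pow_two_mul]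
  push_cast
  have : ((-1 : ℂ) ^ k) * (-1) ^ k = 1 := by rw [← mul_pow]; simp
  linear_combination ((x i : ℂ) ^ (2 * k) / ((2 * k + 1).factorial : ℂ)) * this

theorem matPhi_conjDiag (h : Q * P = 1) (x : ι → ℝ) :
    matPhi (conjDiag P Q fun i => 2 * (x i : ℂ))
      = conjDiag P Q fun i => ((Real.exp (x i) * sinhc (x i) : ℝ) : ℂ) := by
  refine (hasSum_smul_conjDiag_pow h _ _ (fun k => 1 / ((k + 1).factorial : ℂ))
    (fun k => k) fun i => ?_).tsum_eq
  convert (Complex.hasSum_ofReal.mpr (hasSum_exp_mul_sinhc (x i))) using 2 with k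
  push_cast
  rfl

theorem exists_conjDiag_of_isHermitian {A : Matrix ι ι ℂ} (hA : A.IsHermitian) :
    ∃ P : Matrix ι ι ℂ, Pᴴ * P = 1 ∧ A = conjDiag P Pᴴ fun i => (hA.eigenvalues i : ℂ) := by
  refine ⟨hA.eigenvectorUnitary, ?_, ?_⟩
  · exact Unitary.coe_star_mul_self hA.eigenvectorUnitary
  · exact hA.spectral_theorem

/-- Diagonalize the Hermitian matrix iX: its eigenvalues x are real, those of X are -ix, and cos and
sinc become cosh and sinhc of real arguments. -/
theorem exists_conjDiag_of_antihermitian {X : Matrix ι ι ℂ} (hX : Xᴴ = -X) :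
    ∃ (P : Matrix ι ι ℂ) (x : ι → ℝ), Pᴴ * P = 1 ∧
      Complex.I • X = conjDiag P Pᴴ (fun i => (x i : ℂ)) ∧
      X = conjDiag P Pᴴ (fun i => -Complex.I * x i) := by
  have hA : (Complex.I • X).IsHermitian := by
    rw [Matrix.IsHermitian, Matrix.conjTranspose_smul, hX]
    simp
  obtain ⟨P, hP, e⟩ := exists_conjDiag_of_isHermitian hA
  generalize hA.eigenvalues = x at e
  refine ⟨P, x, hP, e, ?_⟩
  have : X = (-Complex.I) • (Complex.I • X) := by
    rw [smul_smul]; simp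
  rw [this, e, ← map_smul]
  rfl

theorem det_one_sub_smul_pos_of_isHermitian {B : Matrix ι ι ℂ} (hB : B.IsHermitian) {θ : ℝ}
    (h : ∀ x : ℝ, (x : ℂ) ∈ spectrum ℂ B → θ * x < 1) :
    ∃ y : ℝ, 0 < y ∧ (1 - (θ : ℂ) • B).det = y := by
  obtain ⟨P, hP, e⟩ := exists_conjDiag_of_isHermitian hB
  refine ⟨∏ i, (1 - θ * hB.eigenvalues i), Finset.prod_pos fun i _ => ?_, ?_⟩
  · rw [sub_pos]
    apply h
    rw [hB.spectrum_eq_image_range]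
    exact ⟨_, ⟨i, rfl⟩, rfl⟩
  · have : 1 - (θ : ℂ) • B
        = conjDiag P Pᴴ (1 - (θ : ℂ) • fun i => (hB.eigenvalues i : ℂ)) := by
      rw [map_sub, map_smul, conjDiag_one hP, ← e]
    rw [this, det_conjDiag hP]
    simp

/-- Positivity of `det (cos X - θ Φ sinc X)` for an antihermitian matrix `X` and a Hermitian
matrix `Φ` under a constraint on the spectrum of `Φ tanc X`. -/
theorem det_cos_sub_pos {X Φ : Matrix ι ι ℂ} (hX : Xᴴ = -X) (hΦ : Φ.IsHermitian) {θ : ℝ}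
    (h : ∀ x : ℝ, (x : ℂ) ∈ spectrum ℂ (Φ * matTanc X) → θ * x < 1) :
    ∃ y : ℝ, 0 < y ∧ (matCos X - (θ : ℂ) • (Φ * matSinc X)).det = y := by
  obtain ⟨P, x, hP, e, eX⟩ := exists_conjDiag_of_antihermitian hX
  have eC := matCos_conjDiag hP x
  have eS := matSinc_conjDiag hP x
  rw [← eX] at eC eS
  -- R is the positive square root of tanc X, whose eigenvalues are tanh(x)/x > 0. Then Φ tanc X =
  -- R⁻¹(RΦR)R is similar to a Hermitian matrix.
  set q : ι → ℝ := fun i => Real.sqrt (sinhc (x i) / Real.cosh (x i)) with hq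
  have hq0 : ∀ i, 0 < q i := fun i => Real.sqrt_pos.mpr (div_pos (sinhc_pos _) (Real.cosh_pos _))
  have hqq : ∀ i, q i * q i * Real.cosh (x i) = sinhc (x i) := fun i => by
    rw [Real.mul_self_sqrt (div_pos (sinhc_pos _) (Real.cosh_pos _)).le]
    have := (Real.cosh_pos (x i)).ne'
    field_simp
  set R := conjDiag P Pᴴ fun i => (q i : ℂ) with hR
  set R' := conjDiag P Pᴴ fun i => ((q i)⁻¹ : ℂ) with hR'
  have hRR' : R * R' = 1 := by
    rw [hR, hR', conjDiag_mul hP, ← conjDiag_one hP]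
    congr 1
    funext i
    have := (hq0 i).ne'
    simp [this]
  have hR'R : R' * R = 1 := mul_eq_one_comm.mp hRR'
  have hS : matSinc X = R * R * matCos X := by
    rw [eC, eS, hR, conjDiag_mul hP, conjDiag_mul hP]
    congr 1
    funext i
    rw [← hqq i]
    push_cast
    rfl
  have hC : (matCos X).det = ((∏ i, Real.cosh (x i) : ℝ) : ℂ) := by
    rw [eC, det_conjDiag hP]
    push_cast
    rfl
  have hC0 : 0 < ∏ i, Real.cosh (x i) := Finset.prod_pos fun i _ => Real.cosh_pos _
  have hCu : IsUnit (matCos X).det := by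
    rw [hC, isUnit_iff_ne_zero]
    exact_mod_cast hC0.ne'
  have hT : matTanc X = R * R := by
    rw [matTanc, hS, mul_assoc, Matrix.mul_nonsing_inv _ hCu, mul_one]
  have hB : (R * Φ * R).IsHermitian := by
    have hRh : Rᴴ = R := conjTranspose_conjDiag rfl q
    rw [Matrix.IsHermitian, Matrix.conjTranspose_mul, Matrix.conjTranspose_mul, hRh, hΦ.eq,
      mul_assoc]
  let u : (Matrix ι ι ℂ)ˣ := ⟨R, R', hRR', hR'R⟩
  have hconj : Φ * matTanc X = R' * (R * Φ * R) * R := by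
    rw [hT]
    calc Φ * (R * R) = 1 * Φ * R * R := by simp only [mul_assoc, one_mul]
      _ = _ := by rw [← hR'R]; simp only [mul_assoc]
  have hspec : spectrum ℂ (Φ * matTanc X) = spectrum ℂ (R * Φ * R) := by
    rw [hconj]
    exact spectrum.units_conjugate' (u := u)
  rw [hspec] at h
  obtain ⟨y, hy, ey⟩ := det_one_sub_smul_pos_of_isHermitian hB h
  refine ⟨y * ∏ i, Real.cosh (x i), mul_pos hy hC0, ?_⟩
  -- This is cos X - θΦ sinc X = (1 - θΦ tanc X) cos X, and det cos X is a product of hyperbolic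
  -- cosines.
  have : matCos X - (θ : ℂ) • (Φ * matSinc X)
      = R' * (1 - (θ : ℂ) • (R * Φ * R)) * R * matCos X := by
    have h2 : R' * (1 - (θ : ℂ) • (R * Φ * R)) * R = 1 - (θ : ℂ) • (Φ * matTanc X) := by
      rw [hconj]
      simp only [mul_sub, sub_mul, mul_one, hR'R, Matrix.mul_smul, Matrix.smul_mul]
    rw [h2, sub_mul, one_mul, Matrix.smul_mul, hT, hS]
    simp only [mul_assoc]
  have hdet : R'.det * R.det = 1 := by rw [← Matrix.det_mul, hR'R, Matrix.det_one]
  rw [this, Matrix.det_mul, Matrix.det_mul, Matrix.det_mul, ey, hC]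
  rw [Complex.ofReal_mul]
  linear_combination (y : ℂ) * ((∏ i, Real.cosh (x i) : ℝ) : ℂ) * hdet

/-- The identity `1 - (Θ - H) φ(2H) = (cosh H - Θ sinhc H) exp H` for `H = i X`, at the level of
determinants. -/
theorem det_one_sub_mul_matPhi {X : Matrix ι ι ℂ} (hX : Xᴴ = -X) (Φ : Matrix ι ι ℂ) :
    (1 - (Φ - Complex.I • X) * matPhi ((2 * Complex.I) • X)).det
      = (matCos X - Φ * matSinc X).det * Complex.exp (Complex.I * X.trace) := by
  obtain ⟨P, x, hP, e, eX⟩ := exists_conjDiag_of_antihermitian hX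
  have e2 : (2 * Complex.I) • X = conjDiag P Pᴴ fun i => 2 * (x i : ℂ) := by
    rw [mul_smul, e, ← map_smul]
    rfl
  have eC := matCos_conjDiag hP x
  have eS := matSinc_conjDiag hP x
  have eP := matPhi_conjDiag hP x
  rw [← eX] at eC eS
  rw [← e2] at eP
  set Ex := conjDiag P Pᴴ fun i => Complex.exp (x i) with hEx
  have h1 : matPhi ((2 * Complex.I) • X) = matSinc X * Ex := by
    rw [eP, eS, hEx, conjDiag_mul hP]
    congr 1
    funext i
    push_cast
    exact mul_comm _ _
  have h2 : 1 + Complex.I • X * matPhi ((2 * Complex.I) • X) = matCos X * Ex := by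
    rw [eP, eC, e, hEx, conjDiag_mul hP, conjDiag_mul hP, ← conjDiag_one hP, ← map_add]
    congr 1
    funext i
    -- In other words, 1 + e^x sinh x = e^x cosh x.
    have h3 : (1 : ℝ) + x i * (Real.exp (x i) * sinhc (x i)) = Real.cosh (x i) * Real.exp (x i) := by
      have h4 := sinhc_mul_self (x i)
      rw [Real.sinh_eq] at h4
      have : Real.exp (x i) * Real.exp (-(x i)) = 1 := by rw [← Real.exp_add]; simp
      rw [Real.cosh_eq]
      linear_combination Real.exp (x i) * h4 - this
    have := congrArg (Complex.ofReal) h3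
    push_cast at this
    simpa using this
  have h3 : 1 - (Φ - Complex.I • X) * matPhi ((2 * Complex.I) • X)
      = (matCos X - Φ * matSinc X) * Ex := by
    rw [sub_mul (matCos X), ← h2, mul_assoc Φ, ← h1, sub_mul]
    abel
  have h4 : Ex.det = Complex.exp (Complex.I * X.trace) := by
    rw [hEx, det_conjDiag hP, ← Complex.exp_sum]
    congr 1
    rw [← smul_eq_mul, ← Matrix.trace_smul, e, trace_conjDiag hP]
  rw [h3, Matrix.det_mul, h4]

end Diagonalizable

/-! ### Algebra of the spectral functions -/

section SpectralAlgebra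

variable {k₁ k₂ r : ℕ}

theorem fieldJ_transpose (k : ℕ) : (fieldJ k)ᵀ = -fieldJ k := by
  ext ⟨i, a⟩ ⟨j, b⟩
  simp only [fieldJ, Matrix.transpose_apply, Matrix.kroneckerMap_apply, Matrix.neg_apply,
    Matrix.one_apply]
  by_cases h : i = j
  · subst h
    fin_cases a <;> fin_cases b <;> simp
  · simp [h, Ne.symm h]

theorem fieldJ_mul_self (k : ℕ) : fieldJ k * fieldJ k = -1 := by
  rw [fieldJ, ← Matrix.mul_kronecker_mul, one_mul]
  have : (!![0, 1; -1, 0] * !![0, 1; -1, 0] : Matrix (Fin 2) (Fin 2) ℝ) = (-1 : ℝ) • 1 := by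
    ext a b
    fin_cases a <;> fin_cases b <;> simp
  rw [this, Matrix.kronecker_smul, Matrix.one_kronecker_one, neg_one_smul]

theorem noiseJ_transpose (k₁ k₂ : ℕ) : (noiseJ k₁ k₂)ᵀ = -noiseJ k₁ k₂ := by
  rw [noiseJ, Matrix.fromBlocks_transpose, fieldJ_transpose, fieldJ_transpose,
    Matrix.fromBlocks_neg]
  simp

theorem noiseJ_mul_self (k₁ k₂ : ℕ) : noiseJ k₁ k₂ * noiseJ k₁ k₂ = -1 := by
  rw [noiseJ, Matrix.fromBlocks_multiply, fieldJ_mul_self, fieldJ_mul_self,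
    ← Matrix.fromBlocks_one, Matrix.fromBlocks_neg]
  simp

theorem noiseJC_transpose (k₁ k₂ : ℕ) : (noiseJC k₁ k₂)ᵀ = -noiseJC k₁ k₂ := by
  ext i j
  have := congrFun (congrFun (noiseJ_transpose k₁ k₂) i) j
  simp only [Matrix.transpose_apply, Matrix.neg_apply] at this
  simp [noiseJC, this]

theorem noiseJC_conjTranspose (k₁ k₂ : ℕ) : (noiseJC k₁ k₂)ᴴ = -noiseJC k₁ k₂ := by
  rw [← noiseJC_transpose]
  ext i j
  simp [noiseJC]

theorem noiseJC_mul_self (k₁ k₂ : ℕ) : noiseJC k₁ k₂ * noiseJC k₁ k₂ = -1 := by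
  have h := congrArg (fun M => M.map Complex.ofRealHom) (noiseJ_mul_self k₁ k₂)
  simp only [Matrix.map_mul] at h
  refine h.trans ?_
  ext i j
  simp [Matrix.one_apply, apply_ite]

theorem itoMatrix_transpose (k₁ k₂ : ℕ) :
    (itoMatrix k₁ k₂)ᵀ = 1 - Complex.I • noiseJC k₁ k₂ := by
  rw [itoMatrix, Matrix.transpose_add, Matrix.transpose_one, Matrix.transpose_smul,
    noiseJC_transpose, smul_neg, sub_eq_add_neg]

theorem itoRoot_conjTranspose (k₁ k₂ : ℕ) : (itoRoot k₁ k₂)ᴴ = itoRoot k₁ k₂ := by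
  rw [itoRoot, itoMatrix_transpose, Matrix.conjTranspose_smul, Matrix.conjTranspose_sub,
    Matrix.conjTranspose_smul, noiseJC_conjTranspose, Matrix.conjTranspose_one]
  simp

/-- Since (iJ)² = 1, the matrix Ωᵀ = 1 - iJ satisfies (Ωᵀ)² = 2Ωᵀ. -/
theorem itoRoot_mul_self (k₁ k₂ : ℕ) :
    itoRoot k₁ k₂ * itoRoot k₁ k₂ = 1 - Complex.I • noiseJC k₁ k₂ := by
  rw [itoRoot, itoMatrix_transpose, Matrix.smul_mul, Matrix.mul_smul, smul_smul]
  have h1 : (((1 / Real.sqrt 2 : ℝ) : ℂ) * ((1 / Real.sqrt 2 : ℝ) : ℂ)) = 1 / 2 := by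
    rw [← Complex.ofReal_mul, div_mul_div_comm, one_mul, Real.mul_self_sqrt (by norm_num)]
    push_cast
    rfl
  have h2 : (1 - Complex.I • noiseJC k₁ k₂) * (1 - Complex.I • noiseJC k₁ k₂)
      = (2 : ℂ) • (1 - Complex.I • noiseJC k₁ k₂) := by
    rw [mul_sub, mul_one, sub_mul, one_mul, Matrix.smul_mul, Matrix.mul_smul, noiseJC_mul_self,
      smul_smul, Complex.I_mul_I, neg_smul, one_smul, neg_neg, two_smul]
    abel
  rw [h1, h2, smul_smul]
  norm_num

variable (θ : ℝ) (F : Matrix (Fin r) (NoiseIdx k₁ k₂) ℂ)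

theorem specΦ_isHermitian : (specΦ F).IsHermitian := Matrix.isHermitian_mul_conjTranspose_self F

theorem specΨ_conjTranspose : (specΨ F)ᴴ = -specΨ F := by
  simp only [specΨ, Matrix.conjTranspose_mul, Matrix.conjTranspose_conjTranspose,
    noiseJC_conjTranspose, Matrix.neg_mul, Matrix.mul_neg, Matrix.mul_assoc]

theorem two_I_smul_conjTranspose {ι : Type*} {X : Matrix ι ι ℂ} (hX : Xᴴ = -X) :
    ((2 * Complex.I * (θ : ℂ)) • X)ᴴ = (2 * Complex.I * (θ : ℂ)) • X := by
  rw [Matrix.conjTranspose_smul, hX]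
  simp

theorem phiΨ_conjTranspose : (phiΨ θ F)ᴴ = phiΨ θ F := by
  rw [phiΨ, matPhi_conjTranspose, two_I_smul_conjTranspose θ (specΨ_conjTranspose F)]

theorem specDelta_conjTranspose : (specDelta θ F)ᴴ = specDelta θ F := by
  simp only [specDelta, specSigma, Matrix.conjTranspose_sub, Matrix.conjTranspose_one,
    Matrix.conjTranspose_smul, Matrix.conjTranspose_mul, Matrix.conjTranspose_conjTranspose,
    itoRoot_conjTranspose, phiΨ_conjTranspose, Matrix.mul_assoc]
  simp

theorem specSDS_conjTranspose : (specSDS θ F)ᴴ = specSDS θ F := by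
  simp only [specSDS, Matrix.conjTranspose_mul, Matrix.conjTranspose_nonsing_inv,
    itoRoot_conjTranspose, specDelta_conjTranspose, Matrix.mul_assoc]

theorem specVarpi_conjTranspose : (specVarpi θ F)ᴴ = specVarpi θ F := by
  refine matPhi_lower_conjTranspose (two_I_smul_conjTranspose θ (specΨ_conjTranspose F)) ?_
  simp only [Matrix.conjTranspose_mul, Matrix.conjTranspose_conjTranspose,
    specSDS_conjTranspose, Matrix.mul_assoc]

theorem star_det_specDelta : star (specDelta θ F).det = (specDelta θ F).det := by
  rw [← Matrix.det_conjTranspose, specDelta_conjTranspose]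

theorem det_specDelta_ofReal : (((specDelta θ F).det.re : ℝ) : ℂ) = (specDelta θ F).det :=
  Complex.conj_eq_iff_re.mp (star_det_specDelta θ F)

/-- Each summand has the form X ↦ LXR with L and R Hermitian (2iθJ included), and such maps are
self-adjoint by cyclicity of the trace. -/
theorem frobInner_weighting (X Y : Matrix (Fin r) (NoiseIdx k₁ k₂) ℂ) :
    frobInner X (weighting θ F Y) = frobInner (weighting θ F X) Y := by
  change frobInner X (phiΨ θ F * Y * specSDS θ F
      + specVarpi θ F * Y * ((2 * Complex.I * (θ : ℂ)) • noiseJC k₁ k₂))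
    = frobInner (phiΨ θ F * X * specSDS θ F
      + specVarpi θ F * X * ((2 * Complex.I * (θ : ℂ)) • noiseJC k₁ k₂)) Y
  simp only [frobInner, Matrix.conjTranspose_add, Matrix.conjTranspose_mul, specSDS_conjTranspose,
    phiΨ_conjTranspose, specVarpi_conjTranspose,
    two_I_smul_conjTranspose θ (noiseJC_conjTranspose k₁ k₂), Matrix.mul_add, Matrix.add_mul,
    Matrix.trace_add]
  congr 1
  · rw [← Matrix.mul_assoc, Matrix.trace_mul_comm]
    simp only [Matrix.mul_assoc]
  · rw [← Matrix.mul_assoc, Matrix.trace_mul_comm]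
    simp only [Matrix.mul_assoc]

/-- `det Δ_θ = det D_θ exp (i θ Tr Ψ)` -/
theorem det_specDelta : (specDelta θ F).det
    = (specD θ F).det * Complex.exp (Complex.I * ((θ : ℂ) * (specΨ F).trace)) := by
  set X := (θ : ℂ) • specΨ F with hX
  have hXh : Xᴴ = -X := by
    rw [hX, Matrix.conjTranspose_smul, specΨ_conjTranspose]
    simp
  have h2X : (2 * Complex.I * (θ : ℂ)) • specΨ F = (2 * Complex.I) • X := by
    rw [hX, smul_smul]
  -- Written as 1 + UV, the determinant equals det(1 + VU), where the two factors S meet between F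
  -- and F* and become 1 - iJ.
  have h1 : specDelta θ F
      = 1 + (-(θ : ℂ) • (itoRoot k₁ k₂ * Fᴴ * phiΨ θ F)) * (F * itoRoot k₁ k₂) := by
    rw [specDelta, specSigma, Matrix.smul_mul, neg_smul, sub_eq_add_neg]
    simp only [Matrix.mul_assoc]
  have h2 : 1 + (F * itoRoot k₁ k₂) * (-(θ : ℂ) • (itoRoot k₁ k₂ * Fᴴ * phiΨ θ F))
      = 1 - ((θ : ℂ) • specΦ F - Complex.I • X) * matPhi ((2 * Complex.I) • X) := by
    have h3 : (F * itoRoot k₁ k₂) * (itoRoot k₁ k₂ * Fᴴ) = specΦ F - Complex.I • specΨ F := by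
      calc (F * itoRoot k₁ k₂) * (itoRoot k₁ k₂ * Fᴴ)
          = F * (itoRoot k₁ k₂ * itoRoot k₁ k₂) * Fᴴ := by simp only [Matrix.mul_assoc]
        _ = _ := by
          rw [itoRoot_mul_self, Matrix.mul_sub, Matrix.sub_mul, Matrix.mul_one, Matrix.mul_smul,
            Matrix.smul_mul]
          rfl
    have h4 : (θ : ℂ) • specΦ F - Complex.I • X = (θ : ℂ) • (specΦ F - Complex.I • specΨ F) := by
      rw [hX, smul_sub, smul_comm]
    rw [h4, ← h3, phiΨ, h2X, neg_smul, Matrix.mul_neg, ← sub_eq_add_neg, Matrix.mul_smul,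
      Matrix.smul_mul]
    simp only [Matrix.mul_assoc]
  rw [h1, Matrix.det_one_add_mul_comm, h2, det_one_sub_mul_matPhi hXh, specD, ← hX,
    Matrix.smul_mul]
  congr 3
  rw [hX, Matrix.trace_smul, smul_eq_mul]

theorem trace_specΨ_re : (specΨ F).trace.re = 0 := by
  have h := congrArg Matrix.trace (specΨ_conjTranspose F)
  rw [Matrix.trace_conjTranspose, Matrix.trace_neg] at h
  have h2 := congrArg Complex.re h
  simp only [Complex.star_def, Complex.conj_re, Complex.neg_re] at h2
  linarith

theorem det_specDelta_re : (specDelta θ F).det.re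
    = (specD θ F).det.re * Real.exp (-(θ * (specΨ F).trace.im)) := by
  have h : Complex.I * ((θ : ℂ) * (specΨ F).trace) = ((-(θ * (specΨ F).trace.im) : ℝ) : ℂ) := by
    apply Complex.ext
    · simp [trace_specΨ_re]
    · simp [trace_specΨ_re]
  rw [det_specDelta, h, ← Complex.ofReal_exp, Complex.re_mul_ofReal]

/-- Tr Ψ is purely imaginary, so exp(iθ Tr Ψ) is a positive real factor. The logarithms differ by a
term that will integrate to zero. -/
theorem log_det_specD (h : 0 < (specDelta θ F).det.re) :
    Real.log (specD θ F).det.re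
      = Real.log (specDelta θ F).det.re + θ * (specΨ F).trace.im := by
  have h1 := det_specDelta_re θ F
  have hD : 0 < (specD θ F).det.re := by
    rw [h1] at h
    exact pos_of_mul_pos_left h (Real.exp_pos _).le
  rw [h1, Real.log_mul hD.ne' (Real.exp_pos _).ne', Real.log_exp]
  ring

theorem det_specDelta_re_pos
    (h : ∀ x : ℝ, (x : ℂ) ∈ spectrum ℂ (specΦ F * matTanc ((θ : ℂ) • specΨ F)) → θ * x < 1) :
    0 < (specDelta θ F).det.re := by
  have hXh : ((θ : ℂ) • specΨ F)ᴴ = -((θ : ℂ) • specΨ F) := by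
    rw [Matrix.conjTranspose_smul, specΨ_conjTranspose]
    simp
  obtain ⟨y, hy, e⟩ := det_cos_sub_pos hXh (specΦ_isHermitian F) h
  have e' : (specD θ F).det = y := e
  rw [det_specDelta_re, e', Complex.ofReal_re]
  exact mul_pos hy (Real.exp_pos _)

theorem specDelta_zero : specDelta θ (0 : Matrix (Fin r) (NoiseIdx k₁ k₂) ℂ) = 1 := by
  simp [specDelta, specSigma]

end SpectralAlgebra

/-! ### Norms and the real inner product -/

section Norms

variable {ι κ : Type*} [Fintype ι] [Fintype κ]

theorem frobNorm_eq_norm (X : Matrix ι κ ℂ) : frobNorm X = ‖X‖ := by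
  have h : (frobInner X X).re = ∑ i, ∑ j, ‖X i j‖ ^ (2 : ℝ) := by
    rw [frobInner, Matrix.trace, Complex.re_sum]
    simp only [Matrix.diag_apply, Matrix.mul_apply, Matrix.conjTranspose_apply, Complex.re_sum]
    rw [Finset.sum_comm]
    refine Finset.sum_congr rfl fun i _ => Finset.sum_congr rfl fun j _ => ?_
    rw [Real.rpow_two, ← Complex.normSq_eq_norm_sq, Complex.star_def, mul_comm, Complex.mul_conj,
      Complex.ofReal_re]
  rw [frobNorm, h, Matrix.frobenius_norm_def, Real.sqrt_eq_rpow]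

/-- The trace as a continuous linear map. -/
noncomputable def traceL (ι : Type*) [Fintype ι] : Matrix ι ι ℂ →L[ℝ] ℂ :=
  LinearMap.toContinuousLinearMap ((Matrix.traceLinearMap ι ℂ ℂ).restrictScalars ℝ)

/-- The conjugate transpose as a continuous linear map. -/
noncomputable def conjTransposeL (ι κ : Type*) [Fintype ι] [Fintype κ] :
    Matrix ι κ ℂ →L[ℝ] Matrix κ ι ℂ :=
  LinearMap.toContinuousLinearMap
    { toFun := fun M => Mᴴ
      map_add' := fun _ _ => Matrix.conjTranspose_add _ _
      map_smul' := fun c M => by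
        rw [Matrix.conjTranspose_smul]
        simp }

@[simp]
theorem conjTransposeL_apply (M : Matrix ι κ ℂ) : conjTransposeL ι κ M = Mᴴ := rfl

theorem norm_frobInner_le (X Y : Matrix ι κ ℂ) : ‖frobInner X Y‖ ≤ ‖traceL κ‖ * ‖X‖ * ‖Y‖ := by
  have h1 : frobInner X Y = traceL κ (Xᴴ * Y) := rfl
  have h2 : ‖Xᴴ * Y‖ ≤ ‖X‖ * ‖Y‖ := by
    rw [← Matrix.frobenius_norm_conjTranspose X]
    exact Matrix.frobenius_norm_mul _ _
  rw [h1, mul_assoc]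
  exact ((traceL κ).le_opNorm _).trans (mul_le_mul_of_nonneg_left h2 (norm_nonneg _))

/-- The real inner product `(Y, X) ↦ Re ⟨X, Y⟩` of complex matrices. -/
noncomputable def reInner (ι κ : Type*) [Fintype ι] [Fintype κ] :
    Matrix ι κ ℂ →L[ℝ] Matrix ι κ ℂ →L[ℝ] ℝ :=
  LinearMap.mkContinuous₂
    (LinearMap.mk₂ ℝ (fun Y X => (frobInner X Y).re)
      (fun _ _ _ => by simp [frobInner, Matrix.mul_add])
      (fun _ _ _ => by simp [frobInner])
      (fun _ _ _ => by simp [frobInner, Matrix.add_mul])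
      (fun _ _ _ => by simp [frobInner])) ‖traceL κ‖
    (fun Y X => by
      have h := (Complex.abs_re_le_norm (frobInner X Y)).trans (norm_frobInner_le X Y)
      rw [mul_right_comm] at h
      exact h)

end Norms

/-! ### The derivative of the logarithm of the determinant -/

section Det

variable {ι : Type*} [Fintype ι] [DecidableEq ι]

theorem continuous_det : Continuous (Matrix.det : Matrix ι ι ℂ → ℂ) :=
  Continuous.matrix_det continuous_id

theorem differentiable_det : Differentiable ℝ (Matrix.det : Matrix ι ι ℂ → ℂ) := by
  have h : ∀ i j, Differentiable ℝ fun M : Matrix ι ι ℂ => M i j := fun i j =>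
    (LinearMap.toContinuousLinearMap
      ((Matrix.entryLinearMap ℂ ℂ i j).restrictScalars ℝ)).differentiable
  have e : (Matrix.det : Matrix ι ι ℂ → ℂ) =
      fun M => ∑ σ : Equiv.Perm ι, ((Equiv.Perm.sign σ : ℤ) : ℂ) * ∏ i, M (σ i) i := by
    funext M
    rw [Matrix.det_apply']
  rw [e]
  refine Differentiable.fun_sum fun σ _ => Differentiable.const_mul ?_ _
  exact fun M => (HasFDerivAt.finsetProd fun i _ => (h (σ i) i M).hasFDerivAt).differentiableAt

/-- Jacobi's formula -/
theorem fderiv_det_apply (M V : Matrix ι ι ℂ) (hM : IsUnit M.det) :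
    fderiv ℝ Matrix.det M V = M.det * (M⁻¹ * V).trace := by
  have h1 : HasDerivAt (fun t : ℝ => (M + t • V).det) (fderiv ℝ Matrix.det M V) 0 :=
    ((differentiable_det M).hasFDerivAt.hasLineDerivAt V)
  refine h1.unique ?_
  -- The remainder in det(1 + tA) = 1 + t Tr A + t² p(t), which does not affect the derivative at t
  -- = 0.
  set p := (1 + (Polynomial.X : Polynomial ℂ) • (M⁻¹ * V).map Polynomial.C).det.divX.divX
  have h2 : (fun t : ℝ => (M + t • V).det)
      = fun t : ℝ => M.det * (1 + (M⁻¹ * V).trace * t + p.eval (t : ℂ) * (t : ℂ) ^ 2) := by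
    funext t
    rw [← Matrix.det_one_add_smul, ← Matrix.det_mul, mul_add, mul_one, Matrix.mul_smul,
      ← Matrix.mul_assoc, Matrix.mul_nonsing_inv _ hM, Matrix.one_mul]
    rfl
  rw [h2]
  have h3 : HasDerivAt (fun z : ℂ => M.det * (1 + (M⁻¹ * V).trace * z + p.eval z * z ^ 2))
      (M.det * (M⁻¹ * V).trace) ((0 : ℝ) : ℂ) := by
    have hp := p.hasDerivAt (0 : ℂ)
    have := ((((hasDerivAt_id (0 : ℂ)).const_mul (M⁻¹ * V).trace).const_add 1).add
      (hp.mul (hasDerivAt_pow 2 (0 : ℂ)))).const_mul M.det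
    simpa using this
  exact h3.comp_ofReal

end Det

section LogDet

variable {k₁ k₂ r : ℕ} (θ : ℝ)

/-- Because of F* the dependence on F is not holomorphic, so derivatives are taken over ℝ
throughout. -/
theorem hasFDerivAt_specΨ (F : Matrix (Fin r) (NoiseIdx k₁ k₂) ℂ) :
    ∃ L : Matrix (Fin r) (NoiseIdx k₁ k₂) ℂ →L[ℝ] Matrix (Fin r) (Fin r) ℂ,
      HasFDerivAt specΨ L F ∧
      ∀ V, L V = V * noiseJC k₁ k₂ * Fᴴ + F * noiseJC k₁ k₂ * Vᴴ := by
  have h := hasFDerivAt_frobMul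
    (hasFDerivAt_frobMul (hasFDerivAt_id F) (hasFDerivAt_const (noiseJC k₁ k₂) F))
    (conjTransposeL (Fin r) (NoiseIdx k₁ k₂)).hasFDerivAt
  refine ⟨_, h, fun V => ?_⟩
  simp [frobMulL_apply, add_comm]

theorem hasFDerivAt_phiΨ (F : Matrix (Fin r) (NoiseIdx k₁ k₂) ℂ) :
    ∃ L : Matrix (Fin r) (NoiseIdx k₁ k₂) ℂ →L[ℝ] Matrix (Fin r) (Fin r) ℂ,
      HasFDerivAt (phiΨ θ) L F ∧
      ∀ V, L V = fderiv ℝ matPhi ((2 * Complex.I * (θ : ℂ)) • specΨ F)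
        ((2 * Complex.I * (θ : ℂ)) • (V * noiseJC k₁ k₂ * Fᴴ + F * noiseJC k₁ k₂ * Vᴴ)) := by
  obtain ⟨L, hL, eL⟩ := hasFDerivAt_specΨ F
  have h1 : HasFDerivAt
      (fun F : Matrix (Fin r) (NoiseIdx k₁ k₂) ℂ => (2 * Complex.I * (θ : ℂ)) • specΨ F)
      ((2 * Complex.I * (θ : ℂ)) • L) F := hL.fun_const_smul _
  refine ⟨_, (differentiable_matPhi _).hasFDerivAt.comp F h1, fun V => ?_⟩
  simp [eL]

theorem hasFDerivAt_specDelta (F : Matrix (Fin r) (NoiseIdx k₁ k₂) ℂ) :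
    ∃ L : Matrix (Fin r) (NoiseIdx k₁ k₂) ℂ →L[ℝ]
        Matrix (NoiseIdx k₁ k₂) (NoiseIdx k₁ k₂) ℂ,
      HasFDerivAt (specDelta θ) L F ∧
      ∀ V, L V = -((θ : ℂ) • (itoRoot k₁ k₂ * (Vᴴ * phiΨ θ F * F
        + Fᴴ * (fderiv ℝ matPhi ((2 * Complex.I * (θ : ℂ)) • specΨ F)
        ((2 * Complex.I * (θ : ℂ)) • (V * noiseJC k₁ k₂ * Fᴴ + F * noiseJC k₁ k₂ * Vᴴ))) * F
        + Fᴴ * phiΨ θ F * V) * itoRoot k₁ k₂)) := by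
  obtain ⟨L, hL, eL⟩ := hasFDerivAt_phiΨ θ F
  have hS := hasFDerivAt_const (𝕜 := ℝ) (itoRoot k₁ k₂) F
  have h := (((hasFDerivAt_frobMul (hasFDerivAt_frobMul (hasFDerivAt_frobMul
    (hasFDerivAt_frobMul hS (conjTransposeL (Fin r) (NoiseIdx k₁ k₂)).hasFDerivAt) hL)
    (hasFDerivAt_id F)) hS).const_smul (θ : ℂ)).const_sub 1)
  refine ⟨_, h, fun V => ?_⟩
  simp only [conjTransposeL_apply, smul_add, neg_add_rev, ContinuousLinearMap.comp_zero,
    ContinuousLinearMap.comp_id, zero_add, add_zero, _root_.neg_apply,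
    _root_.add_apply, _root_.smul_apply, ContinuousLinearMap.comp_apply,
    ContinuousLinearMap.flip_apply, frobMulL_apply, id, eL, Matrix.mul_add, Matrix.add_mul,
    Matrix.mul_assoc]
  abel

/-- The variations of F* and F contribute complex conjugate traces, and so do the two halves of the
variation of φ. The sum is ⟨V, 𝔐(F)⟩ plus its conjugate. -/
theorem trace_inv_mul_fderiv_specDelta (F V : Matrix (Fin r) (NoiseIdx k₁ k₂) ℂ) :
    ((specDelta θ F)⁻¹ * ((θ : ℂ) • (itoRoot k₁ k₂ * (Vᴴ * phiΨ θ F * F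
        + Fᴴ * (fderiv ℝ matPhi ((2 * Complex.I * (θ : ℂ)) • specΨ F)
        ((2 * Complex.I * (θ : ℂ)) • (V * noiseJC k₁ k₂ * Fᴴ + F * noiseJC k₁ k₂ * Vᴴ))) * F
        + Fᴴ * phiΨ θ F * V) * itoRoot k₁ k₂))).trace
      = (θ : ℂ) * (2 * (frobInner V (weighting θ F F)).re : ℝ) := by
  rw [Matrix.mul_smul, Matrix.trace_smul, smul_eq_mul]
  congr 1
  set c := (2 * Complex.I * (θ : ℂ)) with hc
  set J := noiseJC k₁ k₂
  set W := fderiv ℝ matPhi (c • specΨ F) (c • (V * J * Fᴴ + F * J * Vᴴ)) with hW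
  set φ := phiΨ θ F with hφ
  set G := specSDS θ F with hG
  set ϖ := specVarpi θ F with hϖ
  have h1 : ∀ M : Matrix (NoiseIdx k₁ k₂) (NoiseIdx k₁ k₂) ℂ,
      ((specDelta θ F)⁻¹ * (itoRoot k₁ k₂ * M * itoRoot k₁ k₂)).trace = (G * M).trace := by
    intro M
    rw [← Matrix.mul_assoc, Matrix.trace_mul_comm, hG, specSDS]
    simp only [Matrix.mul_assoc]
  -- Duality removes the derivative of φ: its trace against F G F* is the trace of ϖ_θ against the
  -- increment of 2iθΨ.
  have h2 : (G * (Fᴴ * W * F)).trace = (ϖ * (c • (V * J * Fᴴ + F * J * Vᴴ))).trace := by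
    rw [hϖ, specVarpi, ← trace_mul_fderiv_matPhi, ← hc, ← hW, ← Matrix.mul_assoc,
      Matrix.trace_mul_comm]
    simp only [hG, Matrix.mul_assoc]
  have hz : frobInner V (weighting θ F F)
      = (Vᴴ * (φ * F * G)).trace + (Vᴴ * (ϖ * F * (c • J))).trace := by
    change frobInner V (φ * F * G + ϖ * F * (c • J)) = _
    rw [frobInner, Matrix.mul_add, Matrix.trace_add]
  have hzs : star (frobInner V (weighting θ F F))
      = (G * (Fᴴ * φ * V)).trace + ((c • J) * Fᴴ * ϖ * V).trace := by
    rw [hz, star_add, ← Matrix.trace_conjTranspose, ← Matrix.trace_conjTranspose]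
    simp only [Matrix.conjTranspose_mul, Matrix.conjTranspose_conjTranspose, hφ, hG, hϖ,
      specSDS_conjTranspose, phiΨ_conjTranspose, specVarpi_conjTranspose, hc,
      two_I_smul_conjTranspose θ (noiseJC_conjTranspose k₁ k₂), Matrix.mul_assoc, J]
  have hre : ((2 * (frobInner V (weighting θ F F)).re : ℝ) : ℂ)
      = frobInner V (weighting θ F F) + star (frobInner V (weighting θ F F)) := by
    rw [Complex.star_def, Complex.add_conj]
  rw [h1, hre, hzs, hz, Matrix.mul_add, Matrix.mul_add, Matrix.trace_add, Matrix.trace_add, h2]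
  have e1 : (G * (Vᴴ * φ * F)).trace = (Vᴴ * (φ * F * G)).trace := by
    rw [Matrix.trace_mul_comm]
    simp only [Matrix.mul_assoc]
  have e2 : (ϖ * (c • (V * J * Fᴴ + F * J * Vᴴ))).trace
      = (Vᴴ * (ϖ * F * (c • J))).trace + ((c • J) * Fᴴ * ϖ * V).trace := by
    rw [smul_add, Matrix.mul_add, Matrix.trace_add, add_comm]
    congr 1
    · rw [Matrix.trace_mul_comm Vᴴ]
      simp only [Matrix.mul_assoc, Matrix.mul_smul, Matrix.smul_mul]
    · rw [Matrix.trace_mul_comm _ V, Matrix.trace_mul_comm ϖ]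
      simp only [Matrix.mul_assoc, Matrix.mul_smul, Matrix.smul_mul]
  rw [e1, e2]
  ring

/-- The derivative of `F ↦ log det Δ_θ` is `-2 θ Re ⟨·, 𝔐_{θ,F}(F)⟩`. -/
theorem hasFDerivAt_log_det_specDelta (F : Matrix (Fin r) (NoiseIdx k₁ k₂) ℂ)
    (hF : 0 < (specDelta θ F).det.re) :
    HasFDerivAt (fun F : Matrix (Fin r) (NoiseIdx k₁ k₂) ℂ => Real.log (specDelta θ F).det.re)
      (-(2 * θ) • reInner _ _ (weighting θ F F)) F := by
  obtain ⟨L, hL, eL⟩ := hasFDerivAt_specDelta θ F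
  have h0 : (specDelta θ F).det ≠ 0 := by
    intro h
    rw [h, Complex.zero_re] at hF
    exact lt_irrefl _ hF
  have h1 := ((differentiable_det (specDelta θ F)).hasFDerivAt.comp F hL)
  have h2 := (Complex.reCLM.hasFDerivAt.comp F h1).log hF.ne'
  refine h2.congr_fderiv ?_
  ext V
  have h3 : fderiv ℝ Matrix.det (specDelta θ F) (L V) = (specDelta θ F).det *
      -((θ : ℂ) * (2 * (frobInner V (weighting θ F F)).re : ℝ)) := by
    rw [fderiv_det_apply _ _ h0.isUnit, eL, Matrix.mul_neg, Matrix.trace_neg,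
      trace_inv_mul_fderiv_specDelta]
  -- det Δ_θ is real, so it can be taken out of the real part.
  have h4 : (fderiv ℝ Matrix.det (specDelta θ F) (L V)).re = (specDelta θ F).det.re *
      -(θ * (2 * (frobInner V (weighting θ F F)).re)) := by
    rw [h3, ← det_specDelta_ofReal]
    have : ((specDelta θ F).det.re : ℂ) * -((θ : ℂ) * (2 * (frobInner V (weighting θ F F)).re : ℝ))
      = (((specDelta θ F).det.re * -(θ * (2 * (frobInner V (weighting θ F F)).re)) : ℝ) : ℂ) := by
      push_cast
      ring
    rw [this, Complex.ofReal_re]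
    simp
  change ((specDelta θ F).det.re)⁻¹ * (fderiv ℝ Matrix.det (specDelta θ F) (L V)).re
    = -(2 * θ) * (frobInner V (weighting θ F F)).re
  rw [h4, ← mul_assoc, inv_mul_cancel₀ hF.ne']
  ring

end LogDet

/-! ### Bounds on compact sets of transfer matrices -/

section CompactBounds

variable {k₁ k₂ r : ℕ} (θ : ℝ)

/-- The set of values of the transfer matrix at which `det Δ_θ` is positive. -/
def posDomain (k₁ k₂ r : ℕ) (θ : ℝ) : Set (Matrix (Fin r) (NoiseIdx k₁ k₂) ℂ) :=
  {F | 0 < (specDelta θ F).det.re}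

theorem continuous_specΨ :
    Continuous (specΨ : Matrix (Fin r) (NoiseIdx k₁ k₂) ℂ → Matrix (Fin r) (Fin r) ℂ) :=
  continuous_iff_continuousAt.mpr fun F =>
    (hasFDerivAt_specΨ F).choose_spec.1.continuousAt

theorem continuous_phiΨ :
    Continuous (phiΨ θ : Matrix (Fin r) (NoiseIdx k₁ k₂) ℂ → Matrix (Fin r) (Fin r) ℂ) :=
  continuous_iff_continuousAt.mpr fun F =>
    (hasFDerivAt_phiΨ θ F).choose_spec.1.continuousAt

theorem continuous_specDelta : Continuous (specDelta θ :
    Matrix (Fin r) (NoiseIdx k₁ k₂) ℂ → Matrix (NoiseIdx k₁ k₂) (NoiseIdx k₁ k₂) ℂ) :=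
  continuous_iff_continuousAt.mpr fun F =>
    (hasFDerivAt_specDelta θ F).choose_spec.1.continuousAt

theorem isOpen_posDomain : IsOpen (posDomain k₁ k₂ r θ) :=
  isOpen_lt continuous_const
    (Complex.continuous_re.comp (continuous_det.comp (continuous_specDelta θ)))

theorem zero_mem_posDomain : (0 : Matrix (Fin r) (NoiseIdx k₁ k₂) ℂ) ∈ posDomain k₁ k₂ r θ := by
  change 0 < (specDelta θ 0).det.re
  rw [specDelta_zero, Matrix.det_one]
  exact one_pos

theorem continuousOn_specSDS : ContinuousOn (specSDS θ :
    Matrix (Fin r) (NoiseIdx k₁ k₂) ℂ → _) (posDomain k₁ k₂ r θ) := by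
  intro F hF
  have h0 : (specDelta θ F).det ≠ 0 := by
    intro h
    have hF' : 0 < (specDelta θ F).det.re := hF
    rw [h, Complex.zero_re] at hF'
    exact lt_irrefl _ hF'
  have h1 : ContinuousAt Ring.inverse (specDelta θ F).det := by
    rw [Ring.inverse_eq_inv']
    exact continuousAt_inv₀ h0
  have h2 : ContinuousAt (fun M : Matrix (NoiseIdx k₁ k₂) (NoiseIdx k₁ k₂) ℂ => M⁻¹)
      (specDelta θ F) := continuousAt_matrix_inv _ h1
  have h3 : ContinuousAt (fun F => (specDelta θ F)⁻¹) F :=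
    ContinuousAt.comp (f := specDelta θ) h2 (continuous_specDelta θ).continuousAt
  have h4 : Continuous fun M : Matrix (NoiseIdx k₁ k₂) (NoiseIdx k₁ k₂) ℂ =>
      itoRoot k₁ k₂ * M * itoRoot k₁ k₂ :=
    continuous_frobMul (continuous_frobMul continuous_const continuous_id) continuous_const
  exact (ContinuousAt.comp (f := fun F => (specDelta θ F)⁻¹)
    h4.continuousAt h3).continuousWithinAt

theorem continuousOn_specVarpi : ContinuousOn (specVarpi θ :
    Matrix (Fin r) (NoiseIdx k₁ k₂) ℂ → _) (posDomain k₁ k₂ r θ) := by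
  have h1 : ContinuousOn (fun F : Matrix (Fin r) (NoiseIdx k₁ k₂) ℂ => F * specSDS θ F * Fᴴ)
      (posDomain k₁ k₂ r θ) := by
    rw [continuousOn_iff_continuous_domRestrict]
    have h2 := (continuousOn_specSDS (k₁ := k₁) (k₂ := k₂) (r := r) θ).domRestrict
    exact continuous_frobMul (continuous_frobMul continuous_subtype_val h2)
      ((conjTransposeL (Fin r) (NoiseIdx k₁ k₂)).continuous.comp continuous_subtype_val)
  have h3 : ContinuousOn (fun F : Matrix (Fin r) (NoiseIdx k₁ k₂) ℂ =>
      (Matrix.fromBlocks ((2 * Complex.I * (θ : ℂ)) • specΨ F) 0 (F * specSDS θ F * Fᴴ)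
        ((2 * Complex.I * (θ : ℂ)) • specΨ F) : Matrix (Fin r ⊕ Fin r) (Fin r ⊕ Fin r) ℂ))
      (posDomain k₁ k₂ r θ) := by
    rw [continuousOn_iff_continuous_domRestrict] at h1 ⊢
    have h4 : Continuous fun F : posDomain k₁ k₂ r θ =>
        (2 * Complex.I * (θ : ℂ)) • specΨ (F : Matrix (Fin r) (NoiseIdx k₁ k₂) ℂ) := by
      have h5 : Continuous fun F : posDomain k₁ k₂ r θ =>
          specΨ (F : Matrix (Fin r) (NoiseIdx k₁ k₂) ℂ) :=
        continuous_specΨ.comp continuous_subtype_val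
      exact h5.fun_const_smul _
    exact Continuous.matrix_fromBlocks h4 continuous_const h1 h4
  exact (continuous_blockBL.comp continuous_matPhi).comp_continuousOn h3

/-- The weighting operator applied to the transfer matrix itself is continuous. -/
theorem continuous_weighting_apply {α : Type*} [TopologicalSpace α]
    {f g : α → Matrix (Fin r) (NoiseIdx k₁ k₂) ℂ} (hf : Continuous f) (hg : Continuous g)
    (h : ∀ x, f x ∈ posDomain k₁ k₂ r θ) : Continuous fun x => weighting θ (f x) (g x) := by
  have h1 : Continuous fun x => specSDS θ (f x) := (continuousOn_specSDS θ).comp_continuous hf h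
  have h2 : Continuous fun x => specVarpi θ (f x) :=
    (continuousOn_specVarpi θ).comp_continuous hf h
  have h3 : Continuous fun x => phiΨ θ (f x) := (continuous_phiΨ θ).comp hf
  exact (continuous_frobMul (continuous_frobMul h3 hg) h1).add
    (continuous_frobMul (continuous_frobMul h2 hg) continuous_const)

theorem exists_norm_weighting_le {K : Set (Matrix (Fin r) (NoiseIdx k₁ k₂) ℂ)} (hK : IsCompact K)
    (hKU : K ⊆ posDomain k₁ k₂ r θ) :
    ∃ c : ℝ, 0 ≤ c ∧ ∀ F ∈ K, ∀ X, ‖weighting θ F X‖ ≤ c * ‖X‖ := by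
  obtain ⟨a, ha⟩ := hK.exists_bound_of_continuousOn (continuous_phiΨ θ).continuousOn
  obtain ⟨b, hb⟩ := hK.exists_bound_of_continuousOn ((continuousOn_specSDS θ).mono hKU)
  obtain ⟨d, hd⟩ := hK.exists_bound_of_continuousOn ((continuousOn_specVarpi θ).mono hKU)
  set J := (2 * Complex.I * (θ : ℂ)) • noiseJC k₁ k₂ with hJ
  refine ⟨|a| * |b| + |d| * ‖J‖, by positivity, fun F hF X => ?_⟩
  have h1 : ‖phiΨ θ F * X * specSDS θ F‖ ≤ |a| * ‖X‖ * |b| :=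
    (Matrix.frobenius_norm_mul _ _).trans (mul_le_mul
      ((Matrix.frobenius_norm_mul _ _).trans (mul_le_mul_of_nonneg_right
        ((ha F hF).trans (le_abs_self a)) (norm_nonneg _)))
      ((hb F hF).trans (le_abs_self b)) (norm_nonneg _) (by positivity))
  have h2 : ‖specVarpi θ F * X * J‖ ≤ |d| * ‖X‖ * ‖J‖ :=
    (Matrix.frobenius_norm_mul _ _).trans (mul_le_mul_of_nonneg_right
      ((Matrix.frobenius_norm_mul _ _).trans (mul_le_mul_of_nonneg_right
        ((hd F hF).trans (le_abs_self d)) (norm_nonneg _))) (norm_nonneg _))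
  calc ‖weighting θ F X‖ = ‖phiΨ θ F * X * specSDS θ F + specVarpi θ F * X * J‖ := rfl
    _ ≤ |a| * ‖X‖ * |b| + |d| * ‖X‖ * ‖J‖ := norm_add_le_of_le h1 h2
    _ = _ := by ring

/-- `log det Δ_θ` is quadratically small in the transfer matrix. -/
theorem exists_abs_log_det_le {K : Set (Matrix (Fin r) (NoiseIdx k₁ k₂) ℂ)} (hK : IsCompact K)
    (hKU : K ⊆ posDomain k₁ k₂ r θ) :
    ∃ c : ℝ, ∀ F ∈ K, |Real.log (specDelta θ F).det.re| ≤ c * ‖F‖ ^ 2 := by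
  -- Small and large F are treated separately. The ball of radius ρ need not lie in K, only in the
  -- domain where det Δ_θ is positive.
  obtain ⟨ρ, hρ, hball⟩ := Metric.nhds_basis_closedBall.mem_iff.mp
    ((isOpen_posDomain (k₁ := k₁) (k₂ := k₂) (r := r) θ).mem_nhds (zero_mem_posDomain θ))
  have : ProperSpace (Matrix (Fin r) (NoiseIdx k₁ k₂) ℂ) := FiniteDimensional.proper_real _
  obtain ⟨a, ha0, ha⟩ := exists_norm_weighting_le θ (isCompact_closedBall
    (0 : Matrix (Fin r) (NoiseIdx k₁ k₂) ℂ) ρ) hball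
  have hlog : ContinuousOn (fun F : Matrix (Fin r) (NoiseIdx k₁ k₂) ℂ =>
      Real.log (specDelta θ F).det.re) K := fun F hF =>
    (hasFDerivAt_log_det_specDelta θ F (hKU hF)).continuousAt.continuousWithinAt
  obtain ⟨b, hb⟩ := hK.exists_bound_of_continuousOn hlog
  set c₁ := |2 * θ| * (‖reInner (Fin r) (NoiseIdx k₁ k₂)‖ * a) with hc₁
  refine ⟨max c₁ (|b| / ρ ^ 2), fun F hF => ?_⟩
  rcases le_or_gt ‖F‖ ρ with h | h
  · have hsub : Metric.closedBall (0 : Matrix (Fin r) (NoiseIdx k₁ k₂) ℂ) ‖F‖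
        ⊆ Metric.closedBall 0 ρ := Metric.closedBall_subset_closedBall h
    -- The logarithm vanishes at 0. On the ball of radius ‖F‖, rather than ρ, its gradient is at
    -- most c₁‖F‖, and the mean value inequality yields c₁‖F‖².
    have hmv := (convex_closedBall (0 : Matrix (Fin r) (NoiseIdx k₁ k₂) ℂ) ‖F‖
      ).norm_image_sub_le_of_norm_hasFDerivWithin_le
      (f := fun F => Real.log (specDelta θ F).det.re) (C := c₁ * ‖F‖)
      (fun G hG => (hasFDerivAt_log_det_specDelta θ G (hball (hsub hG))).hasFDerivWithinAt)
      (fun G hG => by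
        have h1 : ‖reInner (Fin r) (NoiseIdx k₁ k₂) (weighting θ G G)‖
            ≤ ‖reInner (Fin r) (NoiseIdx k₁ k₂)‖ * (a * ‖F‖) :=
          ((reInner _ _).le_opNorm _).trans (mul_le_mul_of_nonneg_left
            ((ha G (hsub hG) G).trans (mul_le_mul_of_nonneg_left (by simpa using hG) ha0))
            (norm_nonneg _))
        rw [norm_smul, norm_neg, Real.norm_eq_abs, hc₁]
        calc |2 * θ| * _ ≤ |2 * θ| * (‖reInner (Fin r) (NoiseIdx k₁ k₂)‖ * (a * ‖F‖)) :=
              mul_le_mul_of_nonneg_left h1 (abs_nonneg _)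
          _ = _ := by ring)
      (Metric.mem_closedBall_self (norm_nonneg F)) (y := F) (by simp)
    simp only [specDelta_zero, Matrix.det_one, Complex.one_re, Real.log_one, sub_zero,
      Real.norm_eq_abs] at hmv
    calc |Real.log (specDelta θ F).det.re| ≤ c₁ * ‖F‖ * ‖F‖ := hmv
      _ = c₁ * ‖F‖ ^ 2 := by ring
      _ ≤ _ := mul_le_mul_of_nonneg_right (le_max_left _ _) (by positivity)
  -- Away from 0 a constant bound is enough, as 1 ≤ ‖F‖²/ρ².
  · calc |Real.log (specDelta θ F).det.re| ≤ |b| := (hb F hF).trans (le_abs_self b)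
      _ = |b| / ρ ^ 2 * ρ ^ 2 := by field_simp
      _ ≤ |b| / ρ ^ 2 * ‖F‖ ^ 2 := by gcongr
      _ ≤ _ := mul_le_mul_of_nonneg_right (le_max_right _ _) (by positivity)

end CompactBounds

/-! ### The resolvent on the imaginary axis -/

/-- The decay rate `1 / √(1 + λ²)` of the resolvent. -/
noncomputable def decay (l : ℝ) : ℝ := (Real.sqrt (1 + l ^ 2))⁻¹

theorem decay_pos (l : ℝ) : 0 < decay l := by
  unfold decay
  positivity

theorem decay_sq (l : ℝ) : decay l ^ 2 = (1 + l ^ 2)⁻¹ := by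
  rw [decay, inv_pow, Real.sq_sqrt (by positivity)]

theorem decay_le_one (l : ℝ) : decay l ≤ 1 := by
  unfold decay
  refine inv_le_one_of_one_le₀ ?_
  rw [Real.one_le_sqrt]
  nlinarith [sq_nonneg l]

theorem one_le_mul_decay (l : ℝ) : 1 ≤ (1 + |l|) * decay l := by
  have h : Real.sqrt (1 + l ^ 2) ≤ 1 + |l| := by
    rw [Real.sqrt_le_left (by positivity)]
    nlinarith [abs_nonneg l, sq_abs l]
  rw [decay, ← div_eq_mul_inv, one_le_div (by positivity)]
  exact h

theorem integrable_decay_sq : Integrable fun l => decay l ^ 2 := by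
  simp only [decay_sq]
  exact integrable_inv_one_add_sq

theorem tendsto_decay : Tendsto decay (cocompact ℝ) (𝓝 0) := by
  have h1 : Tendsto (fun l : ℝ => ‖l‖⁻¹) (cocompact ℝ) (𝓝 0) :=
    tendsto_inv_atTop_zero.comp tendsto_norm_cocompact_atTop
  refine squeeze_zero' (Eventually.of_forall fun l => (decay_pos l).le) ?_ h1
  filter_upwards [tendsto_norm_cocompact_atTop.eventually_gt_atTop 0] with l hl
  refine inv_anti₀ hl ?_
  rw [Real.norm_eq_abs, ← Real.sqrt_sq_eq_abs]
  exact Real.sqrt_le_sqrt (by linarith)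

section Resolvent

variable {ι : Type*} [Fintype ι] [DecidableEq ι]

/-- The matrix `i λ I - A` -/
def pencil (A : Matrix ι ι ℂ) (l : ℝ) : Matrix ι ι ℂ :=
  (Complex.I * (l : ℂ)) • (1 : Matrix ι ι ℂ) - A

theorem continuous_pencil (A : Matrix ι ι ℂ) : Continuous (pencil A) := by
  have h : Continuous fun l : ℝ => Complex.I * (l : ℂ) := by fun_prop
  exact (h.smul continuous_const).sub continuous_const

theorem isUnit_pencil {A : Matrix ι ι ℂ} (hA : ∀ μ ∈ spectrum ℂ A, μ.re < 0) (l : ℝ) :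
    IsUnit (pencil A l) := by
  by_contra h
  have h1 : Complex.I * (l : ℂ) ∈ spectrum ℂ A := by
    rw [spectrum.mem_iff, Algebra.algebraMap_eq_smul_one]
    exact h
  have := hA _ h1
  simp at this

theorem pencil_mul_inv {A : Matrix ι ι ℂ} {l : ℝ} (h : IsUnit (pencil A l)) :
    pencil A l * (pencil A l)⁻¹ = 1 :=
  Matrix.mul_nonsing_inv _ ((Matrix.isUnit_iff_isUnit_det _).mp h)

theorem inv_mul_pencil {A : Matrix ι ι ℂ} {l : ℝ} (h : IsUnit (pencil A l)) :
    (pencil A l)⁻¹ * pencil A l = 1 :=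
  Matrix.nonsing_inv_mul _ ((Matrix.isUnit_iff_isUnit_det _).mp h)

theorem hasFDerivAt_matrix_inv {M : Matrix ι ι ℂ} (h : IsUnit M) :
    ∃ L : Matrix ι ι ℂ →L[ℝ] Matrix ι ι ℂ,
      HasFDerivAt (fun M : Matrix ι ι ℂ => M⁻¹) L M ∧ ∀ V, L V = -(M⁻¹ * V * M⁻¹) := by
  obtain ⟨u, rfl⟩ := h
  have h1 := hasFDerivAt_ringInverse (𝕜 := ℝ) u
  have e : (fun M : Matrix ι ι ℂ => M⁻¹) = Ring.inverse := by
    funext M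
    exact Matrix.nonsing_inv_eq_ringInverse M
  rw [e]
  refine ⟨_, h1, fun V => ?_⟩
  rw [← Matrix.coe_units_inv]
  simp [mul_assoc]

theorem continuous_pencil_inv {A : Matrix ι ι ℂ} (h : ∀ l, IsUnit (pencil A l)) :
    Continuous fun l => (pencil A l)⁻¹ := by
  rw [continuous_iff_continuousAt]
  intro l
  obtain ⟨L, hL, -⟩ := hasFDerivAt_matrix_inv (h l)
  exact ContinuousAt.comp (f := pencil A) hL.continuousAt (continuous_pencil A).continuousAt

/-- The resolvent of a Hurwitz matrix decays on the imaginary axis. -/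
theorem exists_norm_pencil_inv_le {A : Matrix ι ι ℂ} (h : ∀ l, IsUnit (pencil A l)) :
    ∃ c : ℝ, 0 < c ∧ ∀ l, ‖(pencil A l)⁻¹‖ ≤ c * decay l := by
  -- Take norms in iλR = 1 + AR for the resolvent R. For |λ| > ‖A‖ + 1 this gives ‖R‖ ≤ ‖1‖; the
  -- remaining frequencies form a compact interval.
  have key : ∀ l, |l| * ‖(pencil A l)⁻¹‖
      ≤ ‖(1 : Matrix ι ι ℂ)‖ + ‖A‖ * ‖(pencil A l)⁻¹‖ := by
    intro l
    have h1 := pencil_mul_inv (h l)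
    have h2 : (Complex.I * (l : ℂ)) • (pencil A l)⁻¹ = 1 + A * (pencil A l)⁻¹ := by
      rw [pencil, sub_mul, Matrix.smul_mul, one_mul] at h1
      rw [← h1, pencil, sub_add_cancel]
    have h3 := congrArg norm h2
    rw [norm_smul, norm_mul, Complex.norm_I, one_mul, Complex.norm_real, Real.norm_eq_abs] at h3
    rw [h3]
    exact norm_add_le_of_le le_rfl (Matrix.frobenius_norm_mul _ _)
  obtain ⟨b, hb⟩ := (isCompact_Icc (a := -(‖A‖ + 1)) (b := ‖A‖ + 1)).exists_bound_of_continuousOn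
    (continuous_pencil_inv h).continuousOn
  set c₀ := max b ‖(1 : Matrix ι ι ℂ)‖ with hc₀
  have h0 : 0 ≤ c₀ := (norm_nonneg _).trans (le_max_right _ _)
  have hbd : ∀ l, ‖(pencil A l)⁻¹‖ ≤ c₀ := by
    intro l
    rcases le_or_gt |l| (‖A‖ + 1) with hl | hl
    · exact (hb l (abs_le.mp hl)).trans (le_max_left _ _)
    · refine le_trans ?_ (le_max_right _ _)
      nlinarith [key l, norm_nonneg (pencil A l)⁻¹]
  -- c₀ bounds ‖R‖ and ‖1‖ + ‖A‖c₀ bounds |λ|‖R‖. The final 1 keeps the constant positive even for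
  -- empty matrices.
  refine ⟨c₀ + ‖(1 : Matrix ι ι ℂ)‖ + ‖A‖ * c₀ + 1, by positivity, fun l => ?_⟩
  have h1 : (1 + |l|) * ‖(pencil A l)⁻¹‖ ≤ c₀ + ‖(1 : Matrix ι ι ℂ)‖ + ‖A‖ * c₀ + 1 := by
    have := mul_le_mul_of_nonneg_left (hbd l) (norm_nonneg A)
    linarith [key l, hbd l]
  calc ‖(pencil A l)⁻¹‖ ≤ ‖(pencil A l)⁻¹‖ * ((1 + |l|) * decay l) :=
        le_mul_of_one_le_right (norm_nonneg _) (one_le_mul_decay l)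
    _ = (1 + |l|) * ‖(pencil A l)⁻¹‖ * decay l := by ring
    _ ≤ _ := mul_le_mul_of_nonneg_right h1 (decay_pos l).le

/-- Stability of the resolvent bound under perturbations. -/
theorem eventually_norm_pencil_inv_le {A : Matrix ι ι ℂ} (h : ∀ l, IsUnit (pencil A l)) :
    ∃ c : ℝ, 0 < c ∧ ∀ᶠ A' in 𝓝 A, ∀ l, IsUnit (pencil A' l) ∧
      ‖(pencil A' l)⁻¹‖ ≤ c * decay l := by
  obtain ⟨c, hc, hbd⟩ := exists_norm_pencil_inv_le h
  refine ⟨2 * c, by positivity, ?_⟩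
  -- This radius makes ‖R(A' - A)‖ ≤ 1/2 at all frequencies. The Neumann series then gives
  -- invertibility, and absorbing half of ‖R'‖ in the resolvent identity gives the factor 2.
  filter_upwards [Metric.ball_mem_nhds A (show 0 < (2 * c)⁻¹ by positivity)] with A' hA' l
  have hd : ‖A' - A‖ < (2 * c)⁻¹ := by rwa [Metric.mem_ball, dist_eq_norm] at hA'
  have hR : ‖(pencil A l)⁻¹‖ ≤ c :=
    (hbd l).trans (mul_le_of_le_one_right hc.le (decay_le_one l))
  have hsmall : ‖(pencil A l)⁻¹ * (A' - A)‖ ≤ 1 / 2 :=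
    calc ‖(pencil A l)⁻¹ * (A' - A)‖ ≤ ‖(pencil A l)⁻¹‖ * ‖A' - A‖ :=
          Matrix.frobenius_norm_mul _ _
      _ ≤ c * (2 * c)⁻¹ := mul_le_mul hR hd.le (norm_nonneg _) hc.le
      _ = 1 / 2 := by field_simp
  have e : pencil A' l = pencil A l * (1 - (pencil A l)⁻¹ * (A' - A)) := by
    rw [mul_sub, mul_one, ← mul_assoc, pencil_mul_inv (h l), one_mul, pencil, pencil]
    abel
  have hu : IsUnit (pencil A' l) := by
    rw [e]
    exact (h l).mul (isUnit_one_sub_of_norm_lt_one (by linarith))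
  refine ⟨hu, ?_⟩
  have e2 : (pencil A' l)⁻¹
      = (pencil A l)⁻¹ + (pencil A l)⁻¹ * (A' - A) * (pencil A' l)⁻¹ := by
    have h1 := pencil_mul_inv hu
    have h2 := congrArg (fun M => (pencil A l)⁻¹ * M) h1
    simp only [mul_one] at h2
    rw [e, ← mul_assoc, ← mul_assoc, inv_mul_pencil (h l), one_mul, ← e, sub_mul, one_mul] at h2
    exact sub_eq_iff_eq_add.mp h2
  have h3 : ‖(pencil A' l)⁻¹‖ ≤ ‖(pencil A l)⁻¹‖ + 1 / 2 * ‖(pencil A' l)⁻¹‖ := by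
    conv_lhs => rw [e2]
    exact norm_add_le_of_le le_rfl ((Matrix.frobenius_norm_mul _ _).trans
      (mul_le_mul_of_nonneg_right hsmall (norm_nonneg _)))
  linarith [hbd l]

end Resolvent

/-! ### The transfer matrix near a stable system -/

section Transfer

variable {n ν k₁ k₂ r : ℕ}

/-- The embedding of real matrices into complex matrices. -/
noncomputable def ofRealL (ι κ : Type*) [Fintype ι] [Fintype κ] :
    Matrix ι κ ℝ →L[ℝ] Matrix ι κ ℂ :=
  LinearMap.toContinuousLinearMap
    { toFun := fun M => M.map Complex.ofReal
      map_add' := fun _ _ => Matrix.map_add _ (fun _ _ => Complex.ofReal_add _ _) _ _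
      map_smul' := fun c M => by
        ext
        simp }

theorem ofRealL_apply {ι κ : Type*} [Fintype ι] [Fintype κ] (M : Matrix ι κ ℝ) :
    ofRealL ι κ M = M.map Complex.ofReal := rfl

theorem norm_ofRealL_apply {ι κ : Type*} [Fintype ι] [Fintype κ] (M : Matrix ι κ ℝ) :
    ‖ofRealL ι κ M‖ = ‖M‖ := by
  rw [ofRealL_apply]
  exact Matrix.frobenius_norm_map_eq M Complex.ofReal Complex.norm_real

/-- The complexified state matrix of the closed-loop system. -/
noncomputable def loopA (n ν k₁ k₂ r : ℕ) :
    LoopMatrices n ν k₁ k₂ r →L[ℝ] Matrix (Fin n ⊕ Fin ν) (Fin n ⊕ Fin ν) ℂ :=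
  (ofRealL _ _).comp (ContinuousLinearMap.fst ℝ _ _)

/-- The complexified input matrix of the closed-loop system. -/
noncomputable def loopB (n ν k₁ k₂ r : ℕ) :
    LoopMatrices n ν k₁ k₂ r →L[ℝ] Matrix (Fin n ⊕ Fin ν) (NoiseIdx k₁ k₂) ℂ :=
  (ofRealL _ _).comp ((ContinuousLinearMap.fst ℝ _ _).comp (ContinuousLinearMap.snd ℝ _ _))

/-- The complexified output matrix of the closed-loop system. -/
noncomputable def loopC (n ν k₁ k₂ r : ℕ) :
    LoopMatrices n ν k₁ k₂ r →L[ℝ] Matrix (Fin r) (Fin n ⊕ Fin ν) ℂ :=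
  (ofRealL _ _).comp ((ContinuousLinearMap.snd ℝ _ _).comp (ContinuousLinearMap.snd ℝ _ _))

theorem norm_loopA_le (Γ : LoopMatrices n ν k₁ k₂ r) : ‖loopA n ν k₁ k₂ r Γ‖ ≤ ‖Γ‖ :=
  (norm_ofRealL_apply Γ.1).le.trans (norm_fst_le Γ)

theorem norm_loopB_le (Γ : LoopMatrices n ν k₁ k₂ r) : ‖loopB n ν k₁ k₂ r Γ‖ ≤ ‖Γ‖ :=
  (norm_ofRealL_apply Γ.2.1).le.trans ((norm_fst_le Γ.2).trans (norm_snd_le Γ))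

theorem norm_loopC_le (Γ : LoopMatrices n ν k₁ k₂ r) : ‖loopC n ν k₁ k₂ r Γ‖ ≤ ‖Γ‖ :=
  (norm_ofRealL_apply Γ.2.2).le.trans ((norm_snd_le Γ.2).trans (norm_snd_le Γ))

/-- The resolvent of the state matrix at the frequency `λ`. -/
noncomputable def loopR (Γ : LoopMatrices n ν k₁ k₂ r) (l : ℝ) :
    Matrix (Fin n ⊕ Fin ν) (Fin n ⊕ Fin ν) ℂ :=
  (pencil (loopA n ν k₁ k₂ r Γ) l)⁻¹

theorem freq_eq (Γ : LoopMatrices n ν k₁ k₂ r) (l : ℝ) :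
    freq Γ l = loopC n ν k₁ k₂ r Γ * loopR Γ l * loopB n ν k₁ k₂ r Γ := rfl

/-- The derivative of the transfer matrix with respect to the system matrices. -/
noncomputable def freqDeriv (Γ : LoopMatrices n ν k₁ k₂ r) (l : ℝ) :
    LoopMatrices n ν k₁ k₂ r →L[ℝ] Matrix (Fin r) (NoiseIdx k₁ k₂) ℂ :=
  (frobMulL _ _ _ (loopC n ν k₁ k₂ r Γ * loopR Γ l)).comp (loopB n ν k₁ k₂ r)
    + ((frobMulL _ _ _).flip (loopB n ν k₁ k₂ r Γ)).comp
      ((frobMulL _ _ _ (loopC n ν k₁ k₂ r Γ)).comp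
        ((frobMulL _ _ _ (loopR Γ l)).comp
          (((frobMulL _ _ _).flip (loopR Γ l)).comp (loopA n ν k₁ k₂ r)))
      + ((frobMulL _ _ _).flip (loopR Γ l)).comp (loopC n ν k₁ k₂ r))

theorem freqDeriv_apply (Γ V : LoopMatrices n ν k₁ k₂ r) (l : ℝ) :
    freqDeriv Γ l V = loopC n ν k₁ k₂ r Γ * loopR Γ l * loopB n ν k₁ k₂ r V
      + (loopC n ν k₁ k₂ r Γ * (loopR Γ l * (loopA n ν k₁ k₂ r V * loopR Γ l))
        + loopC n ν k₁ k₂ r V * loopR Γ l) * loopB n ν k₁ k₂ r Γ := rfl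

/-- The product rule with δR = R δ𝒜 R; the sign is positive because 𝒜 enters the pencil iλI - 𝒜
negatively. -/
theorem hasFDerivAt_freq {Γ : LoopMatrices n ν k₁ k₂ r} {l : ℝ}
    (h : IsUnit (pencil (loopA n ν k₁ k₂ r Γ) l)) :
    HasFDerivAt (fun Γ' : LoopMatrices n ν k₁ k₂ r => freq Γ' l) (freqDeriv Γ l) Γ := by
  obtain ⟨L, hL, eL⟩ := hasFDerivAt_matrix_inv h
  have h1 : HasFDerivAt (fun Γ' : LoopMatrices n ν k₁ k₂ r => pencil (loopA n ν k₁ k₂ r Γ') l)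
      (-(loopA n ν k₁ k₂ r)) Γ := (loopA n ν k₁ k₂ r).hasFDerivAt.const_sub _
  have h2 : HasFDerivAt (fun Γ' : LoopMatrices n ν k₁ k₂ r => loopR Γ' l)
      (L.comp (-(loopA n ν k₁ k₂ r))) Γ := hL.comp Γ h1
  have h3 := hasFDerivAt_frobMul (hasFDerivAt_frobMul (loopC n ν k₁ k₂ r).hasFDerivAt h2)
    (loopB n ν k₁ k₂ r).hasFDerivAt
  refine h3.congr_fderiv ?_
  refine ContinuousLinearMap.ext fun V => ?_
  rw [freqDeriv_apply]
  have e : L (-(loopA n ν k₁ k₂ r V)) = loopR Γ l * (loopA n ν k₁ k₂ r V * loopR Γ l) := by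
    rw [eL, Matrix.mul_neg, Matrix.neg_mul, neg_neg, Matrix.mul_assoc]
    rfl
  rw [← e]
  rfl

theorem continuous_freqDeriv {Γ : LoopMatrices n ν k₁ k₂ r}
    (h : ∀ l, IsUnit (pencil (loopA n ν k₁ k₂ r Γ) l)) : Continuous (freqDeriv Γ) := by
  have hR : Continuous (loopR Γ) := continuous_pencil_inv h
  have hCR : Continuous fun l => loopC n ν k₁ k₂ r Γ * loopR Γ l :=
    continuous_frobMul continuous_const hR
  unfold freqDeriv
  fun_prop

theorem continuous_freq {Γ : LoopMatrices n ν k₁ k₂ r}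
    (h : ∀ l, IsUnit (pencil (loopA n ν k₁ k₂ r Γ) l)) : Continuous (freq Γ) :=
  continuous_frobMul (continuous_frobMul continuous_const (continuous_pencil_inv h))
    continuous_const

/-- Uniform bounds for the transfer matrix and its derivative near a stable system. -/
theorem eventually_freq_bounds {Γ₀ : LoopMatrices n ν k₁ k₂ r} (h₀ : IsHurwitz Γ₀) :
    ∃ c : ℝ, 0 < c ∧ ∀ᶠ Γ in 𝓝 Γ₀, ∀ l, IsUnit (pencil (loopA n ν k₁ k₂ r Γ) l) ∧
      ‖freq Γ l‖ ≤ c * decay l ∧ ‖freqDeriv Γ l‖ ≤ c * decay l := by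
  obtain ⟨c, hc, hev⟩ := eventually_norm_pencil_inv_le
    (fun l => isUnit_pencil (A := loopA n ν k₁ k₂ r Γ₀) h₀ l)
  set m := ‖Γ₀‖ + 1 with hm
  have hm0 : 0 < m := by positivity
  -- The sum of the constants for F and for its derivative. Where two resolvents occur, one supplies
  -- the decay and the other is bounded by c.
  refine ⟨m * c * m + (m * c + (m * (c * c) + c) * m), by positivity, ?_⟩
  have h1 := (loopA n ν k₁ k₂ r).continuous.continuousAt.eventually hev
  filter_upwards [h1, Metric.ball_mem_nhds Γ₀ one_pos] with Γ hΓ hball l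
  obtain ⟨hu, hR⟩ := hΓ l
  have hn : ‖Γ‖ ≤ m := by
    have : ‖Γ - Γ₀‖ < 1 := by rwa [Metric.mem_ball, dist_eq_norm] at hball
    have h2 := norm_le_norm_add_norm_sub' Γ Γ₀
    linarith
  have hB := (norm_loopB_le Γ).trans hn
  have hC := (norm_loopC_le Γ).trans hn
  change ‖loopR Γ l‖ ≤ c * decay l at hR
  have hR' : ‖loopR Γ l‖ ≤ c := hR.trans (mul_le_of_le_one_right hc.le (decay_le_one l))
  have hd := (decay_pos l).le
  have hCR : ‖loopC n ν k₁ k₂ r Γ * loopR Γ l‖ ≤ m * (c * decay l) :=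
    (Matrix.frobenius_norm_mul _ _).trans (mul_le_mul hC hR (norm_nonneg _) hm0.le)
  refine ⟨hu, ?_, ?_⟩
  · rw [freq_eq]
    calc _ ≤ m * (c * decay l) * m :=
          (Matrix.frobenius_norm_mul _ _).trans (mul_le_mul hCR hB (norm_nonneg _) (by positivity))
      _ = m * c * m * decay l := by ring
      _ ≤ _ := mul_le_mul_of_nonneg_right (le_add_of_nonneg_right (by positivity)) hd
  · refine ContinuousLinearMap.opNorm_le_bound _ (by positivity) fun V => ?_
    rw [freqDeriv_apply]
    have b1 : ‖loopC n ν k₁ k₂ r Γ * loopR Γ l * loopB n ν k₁ k₂ r V‖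
        ≤ m * (c * decay l) * ‖V‖ :=
      (Matrix.frobenius_norm_mul _ _).trans
        (mul_le_mul hCR (norm_loopB_le V) (norm_nonneg _) (by positivity))
    have b2 : ‖loopA n ν k₁ k₂ r V * loopR Γ l‖ ≤ ‖V‖ * (c * decay l) :=
      (Matrix.frobenius_norm_mul _ _).trans
        (mul_le_mul (norm_loopA_le V) hR (norm_nonneg _) (norm_nonneg _))
    have b3 : ‖loopR Γ l * (loopA n ν k₁ k₂ r V * loopR Γ l)‖ ≤ c * (‖V‖ * (c * decay l)) :=
      (Matrix.frobenius_norm_mul _ _).trans (mul_le_mul hR' b2 (norm_nonneg _) hc.le)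
    have b4 : ‖loopC n ν k₁ k₂ r Γ * (loopR Γ l * (loopA n ν k₁ k₂ r V * loopR Γ l))‖
        ≤ m * (c * (‖V‖ * (c * decay l))) :=
      (Matrix.frobenius_norm_mul _ _).trans (mul_le_mul hC b3 (norm_nonneg _) hm0.le)
    have b5 : ‖loopC n ν k₁ k₂ r V * loopR Γ l‖ ≤ ‖V‖ * (c * decay l) :=
      (Matrix.frobenius_norm_mul _ _).trans
        (mul_le_mul (norm_loopC_le V) hR (norm_nonneg _) (norm_nonneg _))
    have b6 := (Matrix.frobenius_norm_mul
      (loopC n ν k₁ k₂ r Γ * (loopR Γ l * (loopA n ν k₁ k₂ r V * loopR Γ l))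
        + loopC n ν k₁ k₂ r V * loopR Γ l) (loopB n ν k₁ k₂ r Γ)).trans
      (mul_le_mul (norm_add_le_of_le b4 b5) hB (norm_nonneg _) (by positivity))
    calc _ ≤ m * (c * decay l) * ‖V‖
          + (m * (c * (‖V‖ * (c * decay l))) + ‖V‖ * (c * decay l)) * m :=
            norm_add_le_of_le b1 b6
      _ = (m * c + (m * (c * c) + c) * m) * (decay l * ‖V‖) := by ring
      _ ≤ (m * c * m + (m * c + (m * (c * c) + c) * m)) * (decay l * ‖V‖) :=
          mul_le_mul_of_nonneg_right (le_add_of_nonneg_left (by positivity)) (by positivity)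
      _ = _ := by ring

/-- The transfer matrices of systems close to a stable one stay in a compact neighbourhood of
its frequency response. -/
theorem exists_isCompact_freq_mem {Γ₀ : LoopMatrices n ν k₁ k₂ r} (h₀ : IsHurwitz Γ₀)
    {U : Set (Matrix (Fin r) (NoiseIdx k₁ k₂) ℂ)} (hU : IsOpen U) (h0U : 0 ∈ U)
    (hfU : ∀ l, freq Γ₀ l ∈ U) :
    ∃ K, IsCompact K ∧ K ⊆ U ∧ ∀ᶠ Γ in 𝓝 Γ₀, ∀ l, freq Γ l ∈ K := by
  obtain ⟨c, hc, hev⟩ := eventually_freq_bounds h₀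
  have hself := hev.self_of_nhds
  -- The response vanishes at infinity, so adding the point 0 to its range gives a compact set,
  -- which has a closed δ-thickening inside U.
  have ht : Tendsto (freq Γ₀) (cocompact ℝ) (𝓝 0) := by
    refine squeeze_zero_norm (fun l => (hself l).2.1) ?_
    simpa using tendsto_decay.const_mul c
  have hK := ht.isCompact_insert_range_of_cocompact (continuous_freq fun l => (hself l).1)
  have hKU : insert 0 (Set.range (freq Γ₀)) ⊆ U := by
    rintro F (rfl | ⟨l, rfl⟩)
    · exact h0U
    · exact hfU l
  have : ProperSpace (Matrix (Fin r) (NoiseIdx k₁ k₂) ℂ) := FiniteDimensional.proper_real _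
  obtain ⟨δ, hδ, hsub⟩ := hK.exists_cthickening_subset_open hU hKU
  refine ⟨_, hK.cthickening, hsub, ?_⟩
  obtain ⟨ρ, hρ, hball⟩ := Metric.mem_nhds_iff.mp hev
  -- On the ball of radius ρ the derivative of F is at most c at every frequency, so a displacement
  -- of at most δ/c moves F by at most δ.
  filter_upwards [Metric.ball_mem_nhds Γ₀ (show 0 < min ρ (δ / c) by positivity)] with Γ hΓ l
  have hΓρ : Γ ∈ Metric.ball Γ₀ ρ := Metric.ball_subset_ball (min_le_left _ _) hΓ
  have hd : ‖Γ - Γ₀‖ ≤ δ / c := by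
    rw [Metric.mem_ball, dist_eq_norm] at hΓ
    exact (hΓ.trans_le (min_le_right _ _)).le
  have hmv := (convex_ball Γ₀ ρ).norm_image_sub_le_of_norm_hasFDerivWithin_le
    (f := fun Γ => freq Γ l) (C := c)
    (fun Γ' hΓ' => (hasFDerivAt_freq (hball hΓ' l).1).hasFDerivWithinAt)
    (fun Γ' hΓ' => (hball hΓ' l).2.2.trans (mul_le_of_le_one_right hc.le (decay_le_one l)))
    (Metric.mem_ball_self hρ) hΓρ
  refine Metric.mem_cthickening_of_dist_le _ (freq Γ₀ l) δ _ (Or.inr ⟨l, rfl⟩) ?_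
  rw [dist_eq_norm]
  refine hmv.trans ?_
  calc c * ‖Γ - Γ₀‖ ≤ c * (δ / c) := mul_le_mul_of_nonneg_left hd hc.le
    _ = δ := by field_simp

end Transfer

/-! ### Differentiation of frequency-domain integrals -/

section Integrals

variable {n ν k₁ k₂ r : ℕ}

theorem integrable_of_le_norm_freq_sq {E : Type*} [NormedAddCommGroup E]
    {Γ : LoopMatrices n ν k₁ k₂ r} {c C : ℝ} (hC : 0 ≤ C)
    (hf : ∀ l, ‖freq Γ l‖ ≤ c * decay l) {g : ℝ → E} (hm : AEStronglyMeasurable g volume)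
    (hg : ∀ l, ‖g l‖ ≤ C * ‖freq Γ l‖ ^ 2) : Integrable g := by
  refine (integrable_decay_sq.const_mul (C * c ^ 2)).mono' hm (Eventually.of_forall fun l => ?_)
  calc ‖g l‖ ≤ C * ‖freq Γ l‖ ^ 2 := hg l
    _ ≤ C * (c * decay l) ^ 2 := by
      gcongr
      exact hf l
    _ = C * c ^ 2 * decay l ^ 2 := by ring

/-- The gradient bound contributes one factor `decay` and the derivative of F another, giving an
integrable dominating function. The integrand `g` may depend on the frequency so that a frozen
weighting operator is admitted. -/
theorem hasFDerivAt_integral_freq {Γ₀ : LoopMatrices n ν k₁ k₂ r} (h₀ : IsHurwitz Γ₀)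
    {K : Set (Matrix (Fin r) (NoiseIdx k₁ k₂) ℂ)} (hK : ∀ᶠ Γ in 𝓝 Γ₀, ∀ l, freq Γ l ∈ K)
    {g : ℝ → Matrix (Fin r) (NoiseIdx k₁ k₂) ℂ → ℝ}
    {g' : ℝ → Matrix (Fin r) (NoiseIdx k₁ k₂) ℂ → (Matrix (Fin r) (NoiseIdx k₁ k₂) ℂ →L[ℝ] ℝ)}
    {C : ℝ} (hC : 0 ≤ C) (hg : ∀ l, ∀ F ∈ K, HasFDerivAt (g l) (g' l F) F)
    (hg' : ∀ l, ∀ F ∈ K, ‖g' l F‖ ≤ C * ‖F‖) (hb : ∀ l, ∀ F ∈ K, ‖g l F‖ ≤ C * ‖F‖ ^ 2)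
    (hm : ∀ᶠ Γ in 𝓝 Γ₀, AEStronglyMeasurable (fun l => g l (freq Γ l)) volume)
    (hm' : Continuous fun l => g' l (freq Γ₀ l)) :
    (∀ᶠ Γ in 𝓝 Γ₀, Integrable fun l => g l (freq Γ l)) ∧
    HasFDerivAt (fun Γ => ∫ l, g l (freq Γ l))
      (∫ l, (g' l (freq Γ₀ l)).comp (freqDeriv Γ₀ l)) Γ₀ := by
  obtain ⟨c, hc, hev⟩ := eventually_freq_bounds h₀
  have hint : ∀ᶠ Γ in 𝓝 Γ₀, Integrable fun l => g l (freq Γ l) := by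
    filter_upwards [hev, hK, hm] with Γ h1 h2 h3
    exact integrable_of_le_norm_freq_sq hC (fun l => (h1 l).2.1) h3 fun l => hb l _ (h2 l)
  refine ⟨hint, ?_⟩
  have hself := hev.self_of_nhds
  have hs := hev.and hK
  refine hasFDerivAt_integral_of_dominated_of_fderiv_le (μ := volume)
    (F := fun Γ l => g l (freq Γ l))
    (F' := fun Γ l => (g' l (freq Γ l)).comp (freqDeriv Γ l))
    (bound := fun l => C * c * c * decay l ^ 2) hs hm hint.self_of_nhds
    (hm'.clm_comp (continuous_freqDeriv fun l => (hself l).1)).aestronglyMeasurable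
    (Eventually.of_forall fun l Γ hΓ => ?_) (integrable_decay_sq.const_mul _)
    (Eventually.of_forall fun l Γ hΓ => ?_)
  · obtain ⟨h1, h2⟩ := hΓ
    calc ‖(g' l (freq Γ l)).comp (freqDeriv Γ l)‖ ≤ ‖g' l (freq Γ l)‖ * ‖freqDeriv Γ l‖ :=
          ContinuousLinearMap.opNorm_comp_le _ _
      _ ≤ (C * (c * decay l)) * (c * decay l) :=
          mul_le_mul ((hg' l _ (h2 l)).trans (mul_le_mul_of_nonneg_left (h1 l).2.1 hC))
            (h1 l).2.2 (norm_nonneg _) (mul_nonneg hC (mul_nonneg hc.le (decay_pos l).le))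
      _ = C * c * c * decay l ^ 2 := by ring
  · obtain ⟨h1, h2⟩ := hΓ
    exact (hg l _ (h2 l)).comp Γ (hasFDerivAt_freq (h1 l).1)

/-! ### Conjugate symmetry of the frequency response -/

theorem map_ofReal_conjTranspose_transpose {ι κ : Type*} (M : Matrix ι κ ℝ) :
    ((M.map Complex.ofReal)ᴴ)ᵀ = M.map Complex.ofReal := by
  ext i j
  simp

/-- Complex conjugation of the transfer matrix reverses the sign of the frequency. -/
theorem freq_neg (Γ : LoopMatrices n ν k₁ k₂ r) (l : ℝ) : freq Γ (-l) = ((freq Γ l)ᴴ)ᵀ := by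
  have h : pencil (Γ.1.map Complex.ofReal) (-l)
      = ((pencil (Γ.1.map Complex.ofReal) l)ᴴ)ᵀ := by
    rw [pencil, pencil, Matrix.conjTranspose_sub, Matrix.transpose_sub,
      map_ofReal_conjTranspose_transpose, Matrix.conjTranspose_smul]
    simp
  change _ * (pencil (Γ.1.map Complex.ofReal) (-l))⁻¹ * _
    = ((_ * (pencil (Γ.1.map Complex.ofReal) l)⁻¹ * _)ᴴ)ᵀ
  simp only [Matrix.conjTranspose_mul, Matrix.transpose_mul, map_ofReal_conjTranspose_transpose,
    Matrix.conjTranspose_nonsing_inv, Matrix.transpose_nonsing_inv, h, Matrix.mul_assoc]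

/-- F(-λ) is the entrywise conjugate of F(λ) and J is antisymmetric, so Ψ(-λ) = -Ψ(λ)ᵀ. -/
theorem trace_specΨ_freq_neg (Γ : LoopMatrices n ν k₁ k₂ r) (l : ℝ) :
    (specΨ (freq Γ (-l))).trace = -(specΨ (freq Γ l)).trace := by
  rw [freq_neg, ← Matrix.trace_transpose, specΨ, specΨ, Matrix.transpose_mul, Matrix.transpose_mul,
    noiseJC_transpose, Matrix.transpose_transpose, Matrix.neg_mul, Matrix.mul_neg,
    Matrix.trace_neg, ← Matrix.mul_assoc]
  congr 4
  ext i j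
  simp

theorem integral_trace_specΨ_freq (Γ : LoopMatrices n ν k₁ k₂ r) :
    ∫ l, (specΨ (freq Γ l)).trace.im = 0 := by
  have h := integral_neg_eq_self (fun l => (specΨ (freq Γ l)).trace.im) volume
  simp only [trace_specΨ_freq_neg, Complex.neg_im, integral_neg] at h
  linarith

theorem norm_trace_specΨ_le (F : Matrix (Fin r) (NoiseIdx k₁ k₂) ℂ) :
    ‖(specΨ F).trace.im‖ ≤ ‖traceL (Fin r)‖ * ‖noiseJC k₁ k₂‖ * ‖F‖ ^ 2 := by
  have h1 : ‖(specΨ F).trace‖ ≤ ‖traceL (Fin r)‖ * ‖specΨ F‖ := (traceL (Fin r)).le_opNorm _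
  have h2 : ‖specΨ F‖ ≤ ‖F‖ * ‖noiseJC k₁ k₂‖ * ‖F‖ := by
    refine (Matrix.frobenius_norm_mul _ _).trans ?_
    rw [Matrix.frobenius_norm_conjTranspose]
    exact mul_le_mul_of_nonneg_right (Matrix.frobenius_norm_mul _ _) (norm_nonneg _)
  calc ‖(specΨ F).trace.im‖ ≤ ‖(specΨ F).trace‖ := Complex.abs_im_le_norm _
    _ ≤ ‖traceL (Fin r)‖ * (‖F‖ * ‖noiseJC k₁ k₂‖ * ‖F‖) :=
      h1.trans (mul_le_mul_of_nonneg_left h2 (norm_nonneg _))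
    _ = _ := by ring

/-! ### Comparison of the two costs -/

theorem star_frobInner {ι κ : Type*} [Fintype ι] [Fintype κ] (X Y : Matrix ι κ ℂ) :
    star (frobInner X Y) = frobInner Y X := by
  rw [frobInner, ← Matrix.trace_conjTranspose, Matrix.conjTranspose_mul,
    Matrix.conjTranspose_conjTranspose]
  rfl

/-- The derivative of the quadratic form of a self-adjoint operator. -/
theorem hasFDerivAt_quadraticForm {ι κ : Type*} [Fintype ι] [Fintype κ]
    {T : Matrix ι κ ℂ →ₗ[ℂ] Matrix ι κ ℂ}
    (hT : ∀ X Y, frobInner X (T Y) = frobInner (T X) Y) (F : Matrix ι κ ℂ) :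
    HasFDerivAt (fun F => (frobInner F (T F)).re) ((2 : ℝ) • reInner ι κ (T F)) F := by
  have h1 : HasFDerivAt T (LinearMap.toContinuousLinearMap (T.restrictScalars ℝ)) F :=
    (LinearMap.toContinuousLinearMap (T.restrictScalars ℝ)).hasFDerivAt
  have h2 := (reInner ι κ).hasFDerivAt_of_bilinear h1 (hasFDerivAt_id F)
  refine h2.congr_fderiv ?_
  refine ContinuousLinearMap.ext fun V => ?_
  change (frobInner V (T F)).re + (frobInner F (T V)).re = 2 * (frobInner V (T F)).re
  have h3 : (frobInner F (T V)).re = (frobInner V (T F)).re := by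
    rw [hT, ← star_frobInner V (T F)]
    rfl
  rw [h3, two_mul]

/-- Near an admissible closed-loop system, both cost integrals converge and the costs have
proportional derivatives. -/
theorem costs_near {θ : ℝ} {Γ₀ : LoopMatrices n ν k₁ k₂ r} (h₀ : IsHurwitz Γ₀)
    (hs : SpectralConstraint θ Γ₀) :
    (∃ c : ℝ, ∀ l X, ‖weighting θ (freq Γ₀ l) X‖ ≤ c * ‖X‖) ∧
    (∀ᶠ Γ in 𝓝 Γ₀, Integrable (logDetD θ Γ) ∧
      Integrable (weightedDensity (fun l => weighting θ (freq Γ₀ l)) Γ)) ∧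
    ∃ L : LoopMatrices n ν k₁ k₂ r →L[ℝ] ℝ,
      HasFDerivAt (weightedCost fun l => weighting θ (freq Γ₀ l)) L Γ₀ ∧
      HasFDerivAt (qefRate θ) (θ • L) Γ₀ := by
  set 𝔐 : ℝ → Matrix (Fin r) (NoiseIdx k₁ k₂) ℂ →ₗ[ℂ] Matrix (Fin r) (NoiseIdx k₁ k₂) ℂ :=
    fun l => weighting θ (freq Γ₀ l) with h𝔐
  have hpos : ∀ l, freq Γ₀ l ∈ posDomain k₁ k₂ r θ := by
    obtain ⟨ρ, hρ, hspec⟩ := hs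
    exact fun l => det_specDelta_re_pos θ _ fun x hx => (hspec l x hx).trans_lt hρ
  obtain ⟨K, hKc, hKU, hK⟩ := exists_isCompact_freq_mem h₀ (isOpen_posDomain θ)
    (zero_mem_posDomain θ) hpos
  obtain ⟨c, hc, hev⟩ := eventually_freq_bounds h₀
  obtain ⟨a, ha0, ha⟩ := exists_norm_weighting_le θ hKc hKU
  obtain ⟨b, hb⟩ := exists_abs_log_det_le θ hKc hKU
  have hK₀ := hK.self_of_nhds
  have h𝔐a : ∀ l X, ‖𝔐 l X‖ ≤ a * ‖X‖ := fun l X => ha _ (hK₀ l) X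
  have hcont : ∀ᶠ Γ in 𝓝 Γ₀, Continuous (freq Γ) := by
    filter_upwards [hev] with Γ h
    exact continuous_freq fun l => (h l).1
  have hcont₀ := hcont.self_of_nhds
  set N := ‖reInner (Fin r) (NoiseIdx k₁ k₂)‖ with hN
  -- the logarithm of the determinant
  have hlogm : ∀ Γ : LoopMatrices n ν k₁ k₂ r, Continuous (freq Γ) →
      AEStronglyMeasurable (fun l => Real.log (specDelta θ (freq Γ l)).det.re) volume := by
    intro Γ h
    have h1 : Continuous fun l => (specDelta θ (freq Γ l)).det.re :=
      Complex.continuous_re.comp (continuous_det.comp ((continuous_specDelta θ).comp h))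
    exact (Real.measurable_log.comp h1.measurable).aestronglyMeasurable
  have hw₀ : Continuous fun l => weighting θ (freq Γ₀ l) (freq Γ₀ l) :=
    continuous_weighting_apply θ hcont₀ hcont₀ hpos
  -- One constant must serve both bounds: |b| for the quadratic bound on the logarithm, |2θ|Na for
  -- its gradient.
  obtain ⟨hint1, hder1⟩ := hasFDerivAt_integral_freq h₀ hK
    (g := fun _ F => Real.log (specDelta θ F).det.re)
    (g' := fun _ F => -(2 * θ) • reInner _ _ (weighting θ F F))
    (C := max |b| (|2 * θ| * (N * a))) (le_max_of_le_left (abs_nonneg b))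
    (fun _ F hF => hasFDerivAt_log_det_specDelta θ F (hKU hF))
    (fun _ F hF => by
      rw [norm_smul, norm_neg, Real.norm_eq_abs]
      calc |2 * θ| * ‖reInner _ _ (weighting θ F F)‖ ≤ |2 * θ| * (N * (a * ‖F‖)) :=
            mul_le_mul_of_nonneg_left (((reInner _ _).le_opNorm _).trans
              (mul_le_mul_of_nonneg_left (ha F hF F) (norm_nonneg _))) (abs_nonneg _)
        _ = |2 * θ| * (N * a) * ‖F‖ := by ring
        _ ≤ _ := mul_le_mul_of_nonneg_right (le_max_right _ _) (norm_nonneg _))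
    (fun _ F hF => (hb F hF).trans (mul_le_mul_of_nonneg_right
      ((le_abs_self b).trans (le_max_left _ _)) (by positivity)))
    (hcont.mono hlogm)
    (((reInner _ _).continuous.comp hw₀).const_smul (-(2 * θ)))
  -- the quadratic form
  have hdens : ∀ Γ : LoopMatrices n ν k₁ k₂ r, Continuous (freq Γ) →
      Continuous (weightedDensity 𝔐 Γ) := by
    intro Γ h
    exact (traceL (NoiseIdx k₁ k₂)).continuous.comp (continuous_frobMul
      ((conjTransposeL (Fin r) (NoiseIdx k₁ k₂)).continuous.comp h)
      (continuous_weighting_apply θ hcont₀ h hpos))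
  have hdensb : ∀ l F, ‖frobInner F (𝔐 l F)‖ ≤ ‖traceL (NoiseIdx k₁ k₂)‖ * a * ‖F‖ ^ 2 := by
    intro l F
    calc _ ≤ ‖traceL (NoiseIdx k₁ k₂)‖ * ‖F‖ * ‖𝔐 l F‖ := norm_frobInner_le _ _
      _ ≤ ‖traceL (NoiseIdx k₁ k₂)‖ * ‖F‖ * (a * ‖F‖) :=
        mul_le_mul_of_nonneg_left (h𝔐a l F) (by positivity)
      _ = _ := by ring
  obtain ⟨-, hder2⟩ := hasFDerivAt_integral_freq h₀ hK
    (g := fun l F => (frobInner F (𝔐 l F)).re)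
    (g' := fun l F => (2 : ℝ) • reInner _ _ (𝔐 l F))
    (C := max (‖traceL (NoiseIdx k₁ k₂)‖ * a) (2 * (N * a)))
    (le_max_of_le_right (by positivity))
    (fun l F _ => hasFDerivAt_quadraticForm (frobInner_weighting θ _) F)
    (fun l F _ => by
      rw [norm_smul, Real.norm_eq_abs, abs_two]
      calc 2 * ‖reInner _ _ (𝔐 l F)‖ ≤ 2 * (N * (a * ‖F‖)) :=
            mul_le_mul_of_nonneg_left (((reInner _ _).le_opNorm _).trans
              (mul_le_mul_of_nonneg_left (h𝔐a l F) (norm_nonneg _))) zero_le_two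
        _ = 2 * (N * a) * ‖F‖ := by ring
        _ ≤ _ := mul_le_mul_of_nonneg_right (le_max_right _ _) (norm_nonneg _))
    (fun l F _ => ((Complex.abs_re_le_norm _).trans (hdensb l F)).trans
      (mul_le_mul_of_nonneg_right (le_max_left _ _) (by positivity)))
    (hcont.mono fun Γ h => (Complex.continuous_re.comp (hdens Γ h)).aestronglyMeasurable)
    (((reInner _ _).continuous.comp hw₀).const_smul (2 : ℝ))
  -- integrability near the closed-loop system
  have hintD : ∀ᶠ Γ in 𝓝 Γ₀, Integrable (weightedDensity 𝔐 Γ) := by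
    filter_upwards [hcont, hev] with Γ h1 h2
    exact integrable_of_le_norm_freq_sq (by positivity) (fun l => (h2 l).2.1)
      (hdens Γ h1).aestronglyMeasurable fun l => hdensb l _
  have hintΨ : ∀ᶠ Γ in 𝓝 Γ₀, Integrable fun l => (specΨ (freq Γ l)).trace.im := by
    filter_upwards [hcont, hev] with Γ h1 h2
    have h3 : Continuous fun l => (specΨ (freq Γ l)).trace.im :=
      Complex.continuous_im.comp ((traceL (Fin r)).continuous.comp (continuous_specΨ.comp h1))
    exact integrable_of_le_norm_freq_sq (by positivity) (fun l => (h2 l).2.1)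
      h3.aestronglyMeasurable fun l => norm_trace_specΨ_le _
  have hlogD : ∀ᶠ Γ in 𝓝 Γ₀, logDetD θ Γ = fun l =>
      Real.log (specDelta θ (freq Γ l)).det.re + θ * (specΨ (freq Γ l)).trace.im := by
    filter_upwards [hK] with Γ h
    funext l
    exact log_det_specD θ _ (hKU (h l))
  refine ⟨⟨a, h𝔐a⟩, ?_, ?_⟩
  · filter_upwards [hint1, hintD, hintΨ, hlogD] with Γ h1 h2 h3 h4
    rw [h4]
    exact ⟨h1.add (h3.const_mul θ), h2⟩
  have eV : weightedCost 𝔐 =ᶠ[𝓝 Γ₀] fun Γ =>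
      1 / (4 * Real.pi) * ∫ l, (frobInner (freq Γ l) (𝔐 l (freq Γ l))).re := by
    filter_upwards [hintD] with Γ h
    rw [weightedCost]
    congr 1
    exact (Complex.reCLM.integral_comp_comm h).symm
  -- By oddness of Tr Ψ, the passage from D_θ to Δ_θ leaves the integral unchanged.
  have eU : qefRate θ =ᶠ[𝓝 Γ₀] fun Γ =>
      -(1 / (4 * Real.pi)) * ∫ l, Real.log (specDelta θ (freq Γ l)).det.re := by
    filter_upwards [hint1, hintΨ, hlogD] with Γ h1 h3 h4
    rw [qefRate, h4, integral_add h1 (h3.const_mul θ), integral_const_mul,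
      integral_trace_specΨ_freq, mul_zero, add_zero]
  -- At Γ₀ itself the frozen operator is the one generated by the current F, so the two pointwise
  -- derivatives differ exactly by the factor -θ.
  have hD : ∫ l, (-(2 * θ) • reInner _ _ (weighting θ (freq Γ₀ l) (freq Γ₀ l))).comp
        (freqDeriv Γ₀ l)
      = (-θ) • ∫ l, ((2 : ℝ) • reInner _ _ (𝔐 l (freq Γ₀ l))).comp (freqDeriv Γ₀ l) := by
    rw [← integral_smul]
    congr 1
    funext l
    refine ContinuousLinearMap.ext fun V => ?_
    change -(2 * θ) * _ = -θ * (2 * _)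
    ring
  refine ⟨_, (hder2.const_mul (1 / (4 * Real.pi))).congr_of_eventuallyEq eV, ?_⟩
  refine ((hder1.const_mul (-(1 / (4 * Real.pi)))).congr_of_eventuallyEq eU).congr_fderiv ?_
  rw [hD, smul_smul, smul_smul]
  congr 1
  ring

end Integrals

/-! ### Gradients and stationary points -/

section Gradients

variable {n ν k₁ k₂ q₁ q₂ r : ℕ}

theorem matGrad_eq {ι κ : Type*} [Fintype ι] [Fintype κ] [DecidableEq ι] [DecidableEq κ]
    {f : Matrix ι κ ℝ → ℝ} {f' : Matrix ι κ ℝ →L[ℝ] ℝ} {X : Matrix ι κ ℝ}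
    (h : HasFDerivAt f f' X) : matGrad f X = Matrix.of fun i j => f' (Matrix.single i j 1) := by
  ext i j
  exact congrArg (fun L : Matrix ι κ ℝ →L[ℝ] ℝ => L (Matrix.single i j 1)) h.fderiv

/-- Proportional derivatives stay proportional along any differentiable matrix-parametrized slice;
this serves the partial gradients in (𝒜, ℬ, 𝒞) and in (a, b, c, e) alike. -/
theorem matGrad_comp_eq_smul {ι κ E : Type*} [Fintype ι] [Fintype κ] [DecidableEq ι]
    [DecidableEq κ] [NormedAddCommGroup E] [NormedSpace ℝ E] {g : Matrix ι κ ℝ → E}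
    {X : Matrix ι κ ℝ} (hg : DifferentiableAt ℝ g X) {f₁ f₂ : E → ℝ} {θ : ℝ} {L : E →L[ℝ] ℝ}
    (h₁ : HasFDerivAt f₁ (θ • L) (g X)) (h₂ : HasFDerivAt f₂ L (g X)) :
    matGrad (fun X => f₁ (g X)) X = θ • matGrad (fun X => f₂ (g X)) X := by
  have e₁ := matGrad_eq (h₁.comp X hg.hasFDerivAt)
  have e₂ := matGrad_eq (h₂.comp X hg.hasFDerivAt)
  exact e₁.trans (congrArg (θ • ·) e₂).symm

theorem loopGrad_eq_smul {cost₁ cost₂ : LoopMatrices n ν k₁ k₂ r → ℝ}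
    {Γ : LoopMatrices n ν k₁ k₂ r} {θ : ℝ} {L : LoopMatrices n ν k₁ k₂ r →L[ℝ] ℝ}
    (h₁ : HasFDerivAt cost₁ (θ • L) Γ) (h₂ : HasFDerivAt cost₂ L Γ) :
    loopGrad cost₁ Γ = θ • loopGrad cost₂ Γ :=
  Prod.ext (matGrad_comp_eq_smul (g := fun X => (X, Γ.2.1, Γ.2.2)) (by fun_prop) h₁ h₂)
    (Prod.ext (matGrad_comp_eq_smul (g := fun X => (Γ.1, X, Γ.2.2)) (by fun_prop) h₁ h₂)
      (matGrad_comp_eq_smul (g := fun X => (Γ.1, Γ.2.1, X)) (by fun_prop) h₁ h₂))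

/-- The linear part of the affine dependence of the closed-loop system on the controller. -/
def Setup.loopLinear (P : Setup n ν k₁ k₂ q₁ q₂ r) :
    CtrlMatrices ν k₂ q₁ q₂ →ₗ[ℝ] LoopMatrices n ν k₁ k₂ r where
  toFun γ := (Matrix.fromBlocks 0 (P.E * γ.2.2.1) (γ.2.2.2 * P.C) γ.1,
    Matrix.fromBlocks 0 0 (γ.2.2.2 * P.D) γ.2.1, Matrix.fromCols 0 (P.K * γ.2.2.1))
  map_add' γ γ' := by
    refine Prod.ext ?_ (Prod.ext ?_ ?_)
    · simp [Matrix.fromBlocks_add, Matrix.mul_add, Matrix.add_mul]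
    · simp [Matrix.fromBlocks_add, Matrix.add_mul]
    · ext i (j | j) <;> simp [Matrix.mul_add]
  map_smul' c γ := by
    refine Prod.ext ?_ (Prod.ext ?_ ?_)
    · simp [Matrix.fromBlocks_smul]
    · simp [Matrix.fromBlocks_smul]
    · ext i (j | j) <;> simp

theorem Setup.loop_eq (P : Setup n ν k₁ k₂ q₁ q₂ r) (γ : CtrlMatrices ν k₂ q₁ q₂) :
    P.loop γ = P.loopLinear γ
      + (Matrix.fromBlocks P.A 0 0 0, Matrix.fromBlocks P.B (P.E * P.d) 0 0,
        Matrix.fromCols P.N 0) := by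
  refine Prod.ext ?_ (Prod.ext ?_ ?_)
  · simp [Setup.loop, Setup.loopLinear, Matrix.fromBlocks_add]
  · simp [Setup.loop, Setup.loopLinear, Matrix.fromBlocks_add]
  · ext i (j | j) <;> simp [Setup.loop, Setup.loopLinear]

theorem Setup.differentiable_loop (P : Setup n ν k₁ k₂ q₁ q₂ r) : Differentiable ℝ P.loop := by
  have e : P.loop = fun γ => LinearMap.toContinuousLinearMap P.loopLinear γ
      + (Matrix.fromBlocks P.A 0 0 0, Matrix.fromBlocks P.B (P.E * P.d) 0 0,
        Matrix.fromCols P.N 0) := funext P.loop_eq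
  rw [e]
  exact (LinearMap.toContinuousLinearMap P.loopLinear).differentiable.add_const _

theorem ctrlGrad_eq_smul (P : Setup n ν k₁ k₂ q₁ q₂ r)
    {cost₁ cost₂ : LoopMatrices n ν k₁ k₂ r → ℝ} {γ : CtrlMatrices ν k₂ q₁ q₂} {θ : ℝ}
    {L : LoopMatrices n ν k₁ k₂ r →L[ℝ] ℝ} (h₁ : HasFDerivAt cost₁ (θ • L) (P.loop γ))
    (h₂ : HasFDerivAt cost₂ L (P.loop γ)) :
    ctrlGrad P cost₁ γ = θ • ctrlGrad P cost₂ γ := by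
  have hP := P.differentiable_loop
  refine Prod.ext ?_ (Prod.ext ?_ (Prod.ext ?_ ?_))
  · exact matGrad_comp_eq_smul (g := fun X => P.loop (X, γ.2.1, γ.2.2.1, γ.2.2.2))
      (hP.differentiableAt.comp _ (by fun_prop)) h₁ h₂
  · exact matGrad_comp_eq_smul (g := fun X => P.loop (γ.1, X, γ.2.2.1, γ.2.2.2))
      (hP.differentiableAt.comp _ (by fun_prop)) h₁ h₂
  · exact matGrad_comp_eq_smul (g := fun X => P.loop (γ.1, γ.2.1, X, γ.2.2.2))
      (hP.differentiableAt.comp _ (by fun_prop)) h₁ h₂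
  · exact matGrad_comp_eq_smul (g := fun X => P.loop (γ.1, γ.2.1, γ.2.2.1, X))
      (hP.differentiableAt.comp _ (by fun_prop)) h₁ h₂

theorem symPart_mul_smul {ι : Type*} [Fintype ι] (Θ X : Matrix ι ι ℝ) (θ : ℝ) :
    symPart (Θ * (θ • X)) = θ • symPart (Θ * X) := by
  simp only [symPart, Matrix.mul_smul, Matrix.transpose_smul, ← smul_add]
  rw [smul_comm]

theorem antisymPart_mul_smul {ι : Type*} [Fintype ι] (Θ X : Matrix ι ι ℝ) (θ : ℝ) :
    antisymPart (Θ * (θ • X)) = θ • antisymPart (Θ * X) := by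
  simp only [antisymPart, Matrix.mul_smul, Matrix.transpose_smul, ← smul_sub]
  rw [smul_comm]

/-- The optimality conditions are linear and homogeneous in the quadruple of gradients, so a nonzero
factor cancels. -/
theorem isStationaryController_congr (P : Setup n ν k₁ k₂ q₁ q₂ r)
    {cost₁ cost₂ : LoopMatrices n ν k₁ k₂ r → ℝ} {ε : Energetics ν k₂ q₁} {θ : ℝ} (hθ : θ ≠ 0)
    (h : ctrlGrad P cost₁ (P.ctrl ε) = θ • ctrlGrad P cost₂ (P.ctrl ε)) :
    IsStationaryController P cost₁ ε ↔ IsStationaryController P cost₂ ε := by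
  simp only [IsStationaryController]
  rw [h]
  generalize ctrlGrad P cost₂ (P.ctrl ε) = g
  simp only [Prod.smul_fst, Prod.smul_snd, symPart_mul_smul, antisymPart_mul_smul]
  have e2 : (2 : ℝ) • (fieldJ k₂ * ε.2.1 * (θ • antisymPart (P.Θ₂ * g.1)))
      + (θ • g.2.1)ᵀ * P.Θ₂ - fieldJ k₂ * P.dᵀ * (θ • g.2.2.1)
      = θ • ((2 : ℝ) • (fieldJ k₂ * ε.2.1 * antisymPart (P.Θ₂ * g.1)) + g.2.1ᵀ * P.Θ₂
        - fieldJ k₂ * P.dᵀ * g.2.2.1) := by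
    simp only [Matrix.mul_smul, Matrix.smul_mul, Matrix.transpose_smul, smul_add, smul_sub]
    rw [smul_comm]
  have e3 : (2 : ℝ) • (P.Jt₁ * ε.2.2 * (θ • antisymPart (P.Θ₂ * g.1)))
      + (θ • g.2.2.2)ᵀ * P.Θ₂
      = θ • ((2 : ℝ) • (P.Jt₁ * ε.2.2 * antisymPart (P.Θ₂ * g.1)) + g.2.2.2ᵀ * P.Θ₂) := by
    simp only [Matrix.mul_smul, Matrix.smul_mul, Matrix.transpose_smul, smul_add]
    rw [smul_comm]
  rw [e2, e3, smul_eq_zero_iff_right hθ, smul_eq_zero_iff_right hθ, smul_eq_zero_iff_right hθ]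

/-! ### Differentiability in the energy and coupling matrices -/

theorem differentiable_realMul {E ι κ μ : Type*} [Fintype ι] [Fintype κ] [Fintype μ]
    [NormedAddCommGroup E] [NormedSpace ℝ E] {f : E → Matrix ι κ ℝ} {g : E → Matrix κ μ ℝ}
    (hf : Differentiable ℝ f) (hg : Differentiable ℝ g) :
    Differentiable ℝ fun x => f x * g x := by
  let T : Matrix ι κ ℝ →L[ℝ] Matrix κ μ ℝ →L[ℝ] Matrix ι μ ℝ :=
    LinearMap.mkContinuous₂
      (LinearMap.mk₂ ℝ (fun A B => A * B) (fun _ _ _ => Matrix.add_mul _ _ _)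
        (fun _ _ _ => Matrix.smul_mul _ _ _) (fun _ _ _ => Matrix.mul_add _ _ _)
        (fun _ _ _ => Matrix.mul_smul _ _ _)) 1
      (fun A B => by
        rw [one_mul]
        exact Matrix.frobenius_norm_mul A B)
  exact fun x => (T.hasFDerivAt_of_bilinear (hf x).hasFDerivAt (hg x).hasFDerivAt).differentiableAt

theorem differentiable_realTranspose {E ι κ : Type*} [Fintype ι] [Fintype κ]
    [NormedAddCommGroup E] [NormedSpace ℝ E] {f : E → Matrix ι κ ℝ} (hf : Differentiable ℝ f) :
    Differentiable ℝ fun x => (f x)ᵀ :=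
  (LinearMap.toContinuousLinearMap
    (Matrix.transposeLinearEquiv ι κ ℝ ℝ).toLinearMap).differentiable.comp hf

theorem Setup.differentiable_ctrl (P : Setup n ν k₁ k₂ q₁ q₂ r) :
    Differentiable ℝ (P.ctrl : Energetics ν k₂ q₁ → CtrlMatrices ν k₂ q₁ q₂) := by
  let T : Energetics ν k₂ q₁ →ₗ[ℝ] Matrix (Fin ν) (Fin ν) ℝ :=
    (symMat ν).subtype ∘ₗ LinearMap.fst ℝ _ _
  have hR : Differentiable ℝ fun ε : Energetics ν k₂ q₁ =>
      (ε.1 : Matrix (Fin ν) (Fin ν) ℝ) :=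
    (LinearMap.toContinuousLinearMap T).differentiable
  have hM : Differentiable ℝ fun ε : Energetics ν k₂ q₁ => ε.2.1 :=
    differentiable_snd.fst
  have hL : Differentiable ℝ fun ε : Energetics ν k₂ q₁ => ε.2.2 :=
    differentiable_snd.snd
  have hM' := differentiable_realTranspose hM
  have hL' := differentiable_realTranspose hL
  have h2 : ∀ {ι κ : Type} [Fintype ι] [Fintype κ] {f : Energetics ν k₂ q₁ → Matrix ι κ ℝ},
      Differentiable ℝ f → Differentiable ℝ fun x => (2 : ℝ) • f x :=
    fun hf => hf.fun_const_smul 2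
  have hc : ∀ {ι κ : Type} [Fintype ι] [Fintype κ] (M : Matrix ι κ ℝ),
      Differentiable ℝ fun _ : Energetics ν k₂ q₁ => M := fun M => differentiable_const M
  refine Differentiable.prodMk (h2 (differentiable_realMul (hc _) ((hR.add ?_).add ?_)))
    (Differentiable.prodMk (h2 (differentiable_realMul (hc _) hM'))
      (Differentiable.prodMk (h2 (differentiable_realMul (hc _) hM))
        (h2 (differentiable_realMul (hc _) hL'))))
  · exact differentiable_realMul (differentiable_realMul hM' (hc _)) hM
  · exact differentiable_realMul (differentiable_realMul hL' (hc _)) hL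

theorem Setup.differentiable_closedLoop (P : Setup n ν k₁ k₂ q₁ q₂ r) :
    Differentiable ℝ (P.closedLoop : Energetics ν k₂ q₁ → LoopMatrices n ν k₁ k₂ r) :=
  P.differentiable_loop.comp P.differentiable_ctrl

/-- The equivalence of the two problems, with derivatives taken in the Frobenius norm. -/
theorem riskSensitive_weighted_equivalence (P : Setup n ν k₁ k₂ q₁ q₂ r) {θ : ℝ} (hθ : 0 < θ)
    {ε : Energetics ν k₂ q₁} (hε : Admissible P θ ε)
    (𝔐 : ℝ → Matrix (Fin r) (NoiseIdx k₁ k₂) ℂ →ₗ[ℂ] Matrix (Fin r) (NoiseIdx k₁ k₂) ℂ)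
    (h𝔐 : 𝔐 = fun l => weighting θ (freq (P.closedLoop ε) l)) :
    (∀ l X Y, frobInner X (𝔐 l Y) = frobInner (𝔐 l X) Y) ∧
    (∃ c : ℝ, ∀ l X, frobNorm (𝔐 l X) ≤ c * frobNorm X) ∧
    (∀ᶠ Γ in 𝓝 (P.closedLoop ε),
      Integrable (logDetD θ Γ) ∧ Integrable (weightedDensity 𝔐 Γ)) ∧
    DifferentiableAt ℝ (qefRate θ) (P.closedLoop ε) ∧
    DifferentiableAt ℝ (weightedCost 𝔐) (P.closedLoop ε) ∧
    θ⁻¹ • loopGrad (qefRate θ) (P.closedLoop ε) = loopGrad (weightedCost 𝔐) (P.closedLoop ε) ∧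
    (IsStationaryController P (qefRate θ) ε ↔ IsStationaryController P (weightedCost 𝔐) ε) ∧
    (fderiv ℝ (fun ε' => qefRate θ (P.closedLoop ε')) ε = 0 ↔
      fderiv ℝ (fun ε' => weightedCost 𝔐 (P.closedLoop ε')) ε = 0) := by
  subst h𝔐
  obtain ⟨⟨c, hc⟩, hint, L, hV, hU⟩ := costs_near (θ := θ) hε.hurwitz hε.spectral
  refine ⟨fun l X Y => frobInner_weighting θ _ X Y, ⟨c, fun l X => ?_⟩, hint,
    hU.differentiableAt, hV.differentiableAt, ?_, ?_, ?_⟩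
  · rw [frobNorm_eq_norm, frobNorm_eq_norm]
    exact hc l X
  · rw [loopGrad_eq_smul hU hV, smul_smul, inv_mul_cancel₀ hθ.ne', one_smul]
  · exact isStationaryController_congr P hθ.ne' (ctrlGrad_eq_smul P hU hV)
  -- Both derivatives are composites with the same derivative of the closed-loop map, so they too
  -- differ by the factor θ.
  · have hcl := (P.differentiable_closedLoop ε).hasFDerivAt
    have h1 := (hU.comp ε hcl).fderiv
    have h2 := (hV.comp ε hcl).fderiv
    rw [ContinuousLinearMap.smul_comp] at h1
    change fderiv ℝ (fun ε' => qefRate θ (P.closedLoop ε')) ε = _ at h1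
    change fderiv ℝ (fun ε' => weightedCost _ (P.closedLoop ε')) ε = _ at h2
    rw [h1, h2, smul_eq_zero_iff_right hθ.ne']

end Gradients

end FrobeniusTopology

end CQRS

theorem theorem6p1 {n ν k₁ k₂ q₁ q₂ r : ℕ} (P : Setup n ν k₁ k₂ q₁ q₂ r)
    (θ : ℝ) (hθ : 0 < θ) (ε : Energetics ν k₂ q₁) (hε : Admissible P θ ε)
    (𝔐 : ℝ → Matrix (Fin r) (NoiseIdx k₁ k₂) ℂ →ₗ[ℂ] Matrix (Fin r) (NoiseIdx k₁ k₂) ℂ)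
    (h𝔐 : 𝔐 = fun l => weighting θ (freq (P.closedLoop ε) l)) :
    -- the weighting operator is self-adjoint and uniformly bounded over the frequency
    (∀ l X Y, frobInner X (𝔐 l Y) = frobInner (𝔐 l X) Y) ∧
    (∃ c : ℝ, ∀ l X, frobNorm (𝔐 l X) ≤ c * frobNorm X) ∧
    -- near the closed-loop system, both cost integrals converge
    (∀ᶠ Γ in 𝓝 (P.closedLoop ε),
      Integrable (logDetD θ Γ) ∧ Integrable (weightedDensity 𝔐 Γ)) ∧
    -- both costs are Frechet differentiable there as functions of the system matrices
    DifferentiableAt ℝ (qefRate θ) (P.closedLoop ε) ∧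
    DifferentiableAt ℝ (weightedCost 𝔐) (P.closedLoop ε) ∧
    -- the core matrices `θ⁻¹ ∂_Γ Υ_θ` and `∂_Γ V` coincide
    θ⁻¹ • loopGrad (qefRate θ) (P.closedLoop ε) = loopGrad (weightedCost 𝔐) (P.closedLoop ε) ∧
    -- the two problems have the same first-order optimality conditions at the controller
    (IsStationaryController P (qefRate θ) ε ↔ IsStationaryController P (weightedCost 𝔐) ε) ∧
    -- equivalently, the derivatives with respect to `(R₂, M₂, L₂)` vanish simultaneously
    (fderiv ℝ (fun ε' => qefRate θ (P.closedLoop ε')) ε = 0 ↔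
      fderiv ℝ (fun ε' => weightedCost 𝔐 (P.closedLoop ε')) ε = 0) :=
  -- The Frobenius norm induces the entrywise topology definitionally, and the statement involves
  -- norms on matrices only through that topology and through `frobNorm`.
  riskSensitive_weighted_equivalence P hθ hε 𝔐 h𝔐
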